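/- Let $0<\alpha\le\beta\le 1$ and $\mu\in\mathbb{R}$. For $\gamma>-1$ put $A_0^{\gamma}=1$ and $A_n^{\gamma}=\frac{(\gamma+1)(\gamma+2)\cdots(\gamma+n)}{n!}$ for $n\ge 1$, and let $\log^+ x=\max\{\log x,1\}$ for $x>0$ (with $\log^+0=1$). Let $\{X_{k,l}:k,l\ge 0\}$ be independent, identically distributed real random variables, and let $X$ be a random variable with their common distribution. Then the field is almost surely $(C,\alpha,\beta)$-summable to $\mu$, that is, \[ \frac{1}{A_m^{\alpha}A_n^{\beta}}\sum_{k=0}^{m}\sum_{l=0}^{n}A_{m-k}^{\alpha-1}A_{n-l}^{\beta-1}X_{k,l}\longrightarrow\mu\quad\text{almost surely as } m,n\to\infty \] (meaning $\min(m,n)\to\infty$), if and only if \[ \begin{cases} E|X|^{1/\alpha}<\infty, & \text{when } \alpha<\beta,\\ E\big[|X|^{1/\alpha}\log^+|X|\big]<\infty, & \text{when } \alpha=\beta, \end{cases} \] and $E\,X=\mu$ (with $X$ integrable). -/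

import Mathlib

open MeasureTheory ProbabilityTheory Filter Topology

/-- The Cesàro numbers `A_n^α = (α+1)(α+2)⋯(α+n) / n!`, with `A_0^α = 1`. -/
noncomputable def cesaroNumber (α : ℝ) (n : ℕ) : ℝ :=
  (∏ i ∈ Finset.range n, (α + ((i : ℝ) + 1))) / (n.factorial : ℝ)

/-- The `(C,α,β)`-mean with indices `m, n` of the array `x`. -/
noncomputable def cesaroMean (α β : ℝ) (x : ℕ → ℕ → ℝ) (m n : ℕ) : ℝ :=
  1 / (cesaroNumber α m * cesaroNumber β n) *
    ∑ k ∈ Finset.range (m + 1), ∑ l ∈ Finset.range (n + 1),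
      cesaroNumber (α - 1) (m - k) * cesaroNumber (β - 1) (n - l) * x k l

/-- The array `x` is `(C,α,β)`-summable to `s`: its `(C,α,β)`-means converge to `s` as
`m, n → ∞`, that is, as `min m n → ∞`. -/
def IsCesaroSummableTo (α β : ℝ) (x : ℕ → ℕ → ℝ) (s : ℝ) : Prop :=
  Tendsto (fun p : ℕ × ℕ => cesaroMean α β x p.1 p.2) (atTop ×ˢ atTop) (𝓝 s)

/-- The convention `log⁺ x = max {log x, 1}`, used here for `x ≥ 0`; note `Real.log 0 = 0`,
so the value at `0` is `1`. -/
noncomputable def logPlus (x : ℝ) : ℝ := max (Real.log x) 1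

/-! Write `D t = A_m^α A_n^β`, which is comparable to `scale α β t = (m+1)^α (n+1)^β`. The pairs
with `scale < y` are those with `(k+1)(l+1)^(β/α) < y^(1/α)`; their number is of order `z = y^(1/α)`
if `α < β` and `z log z` if `α = β`. By Tonelli the moment condition is therefore equivalent to `∑
P(|X| > ε · scale p) < ∞` (`MomentCondition.tsum_measure_ne_top`,
`momentCondition_of_tsum_measure_ne_top`).

Sufficiency. Borel–Cantelli makes the largest weighted term vanish. If `α < 1` there is a moment of
order `q > 1`; the weights sum to one and are at most `1 / scale`, so an exponential Markov bound
for the truncated sum is summable in `t` (`ae_tendsto_weighted_sum`). The remaining case is `α = β =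
1` with only `L log L`. There the field is split into a bounded part, covered by the same argument,
and a tail of small mean, which Chebyshev along dyadic rectangles and monotonicity control
(`ae_eventually_average_le`).

Necessity. The mean at `t` is `X t / D t + R t` with `R t` independent of `X t`. For large `t`, `R
t` is near `μ` with probability at least one half, so a large `X t / D t` spoils the mean at least
half of the time. Decomposing by the last large term in lexicographic order bounds the probability
of any large term (`mul_measure_biUnion_le`), and independence turns this into a bound on the sum of
probabilities. -/

open scoped ENNReal

/-! ### Cesàro numbers and their growth -/

theorem cesaroNumber_zero_right (α : ℝ) : cesaroNumber α 0 = 1 := by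
  simp [cesaroNumber]

theorem cesaroNumber_succ (α : ℝ) (n : ℕ) :
    cesaroNumber α (n + 1) = cesaroNumber α n * ((α + (n + 1)) / (n + 1)) := by
  unfold cesaroNumber
  rw [Finset.prod_range_succ, Nat.factorial_succ]
  push_cast
  have : (n.factorial : ℝ) ≠ 0 := by positivity
  field_simp

theorem cesaroNumber_pos {α : ℝ} (hα : -1 < α) (n : ℕ) : 0 < cesaroNumber α n := by
  induction n with
  | zero => simp [cesaroNumber_zero_right]
  | succ n ih =>
    rw [cesaroNumber_succ]
    have : (0 : ℝ) ≤ n := n.cast_nonneg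
    exact mul_pos ih (div_pos (by linarith) (by linarith))

theorem cesaroNumber_le_one {α : ℝ} (hα : -1 < α) (hα' : α ≤ 0) (n : ℕ) :
    cesaroNumber α n ≤ 1 := by
  induction n with
  | zero => simp [cesaroNumber_zero_right]
  | succ n ih =>
    rw [cesaroNumber_succ]
    have hn : (0 : ℝ) ≤ n := n.cast_nonneg
    refine mul_le_one₀ ih (div_nonneg (by linarith) (by linarith)) ?_
    rw [div_le_one (by linarith)]
    linarith

theorem cesaroNumber_sub_one_mul (α : ℝ) (n : ℕ) :
    cesaroNumber (α - 1) (n + 1) * (n + 1) = cesaroNumber α n * α := by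
  induction n with
  | zero => simp [cesaroNumber_succ, cesaroNumber_zero_right]
  | succ n ih =>
    have h0 : ((n : ℝ) + 1) ≠ 0 := by positivity
    have h1 : ((n : ℝ) + 1 + 1) ≠ 0 := by positivity
    rw [cesaroNumber_succ (α - 1) (n + 1), cesaroNumber_succ α n]
    have h2 : cesaroNumber (α - 1) (n + 1) = cesaroNumber α n * α / (n + 1) := by
      rw [← ih]; field_simp
    rw [h2]
    push_cast
    field_simp
    ring

theorem sum_cesaroNumber (α : ℝ) (n : ℕ) :
    ∑ k ∈ Finset.range (n + 1), cesaroNumber (α - 1) k = cesaroNumber α n := by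
  induction n with
  | zero => simp [cesaroNumber_zero_right]
  | succ n ih =>
    have h0 : ((n : ℝ) + 1) ≠ 0 := by positivity
    have h2 : cesaroNumber (α - 1) (n + 1) = cesaroNumber α n * α / (n + 1) := by
      rw [← cesaroNumber_sub_one_mul]; field_simp
    rw [Finset.sum_range_succ, ih, h2, cesaroNumber_succ]
    field_simp
    ring

theorem sum_cesaroNumber_reflect (α : ℝ) (n : ℕ) :
    ∑ k ∈ Finset.range (n + 1), cesaroNumber (α - 1) (n - k) = cesaroNumber α n := by
  rw [← sum_cesaroNumber]
  exact Finset.sum_range_reflect (cesaroNumber (α - 1)) (n + 1)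

/-- Bernoulli's inequality `(1 + s)^α ≤ 1 + α s` compares the ratios of consecutive terms. -/
theorem rpow_le_cesaroNumber {α : ℝ} (hα : 0 < α) (hα' : α ≤ 1) (n : ℕ) :
    ((n : ℝ) + 1) ^ α ≤ cesaroNumber α n := by
  induction n with
  | zero => simp [cesaroNumber_zero_right]
  | succ n ih =>
    rw [cesaroNumber_succ]
    have hn : (0 : ℝ) < n + 1 := by positivity
    have h1 : (((n + 1 : ℕ) : ℝ) + 1) ^ α = ((n : ℝ) + 1) ^ α * (1 + 1 / ((n : ℝ) + 1)) ^ α := by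
      rw [← Real.mul_rpow hn.le (by positivity)]
      congr 1
      push_cast
      field_simp
    rw [h1]
    refine mul_le_mul ih ?_ (by positivity) (cesaroNumber_pos (by linarith) n).le
    have h2 := rpow_one_add_le_one_add_mul_self
      (s := 1 / ((n : ℝ) + 1)) (by have : 0 < 1 / ((n : ℝ) + 1) := by positivity
                                   linarith) hα.le hα'
    refine h2.trans (le_of_eq ?_)
    field_simp
    ring

theorem cesaroNumber_le_rpow {α : ℝ} (hα : 0 < α) (hα' : α ≤ 1) (n : ℕ) :
    cesaroNumber α n ≤ 2 * ((n : ℝ) + 1) ^ α := by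
  -- Without the shift the ratios compare the wrong way. With it, `1 + αx ≤ (1 - x)^(-α)` for `x =
  -- 1/(n+2)` closes the induction, and the constant `2` comes from `A_1 = α + 1 ≤ 2`.
  suffices h : cesaroNumber α (n + 1) ≤ 2 * ((n : ℝ) + 1) ^ α by
    refine le_trans ?_ h
    rw [cesaroNumber_succ]
    have hn : (0 : ℝ) < n + 1 := by positivity
    refine le_mul_of_one_le_right (cesaroNumber_pos (by linarith) n).le ?_
    rw [one_le_div hn]
    linarith
  induction n with
  | zero => simp [cesaroNumber_succ, cesaroNumber_zero_right]; linarith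
  | succ n ih =>
    rw [cesaroNumber_succ]
    have hn : (0 : ℝ) < n + 1 := by positivity
    have hn2 : (0 : ℝ) < n + 2 := by positivity
    have h1 : (((n + 1 : ℕ) : ℝ) + 1) ^ α
        = ((n : ℝ) + 1) ^ α * ((1 + -(1 / ((n : ℝ) + 2))) ^ α)⁻¹ := by
      have e : 1 + -(1 / ((n : ℝ) + 2)) = ((n : ℝ) + 1) / (n + 2) := by field_simp; ring
      rw [e, Real.div_rpow hn.le hn2.le]
      have : ((n : ℝ) + 1) ^ α ≠ 0 := by positivity
      have e2 : (((n + 1 : ℕ) : ℝ) + 1) = n + 2 := by push_cast; ring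
      rw [e2]
      field_simp
    rw [h1, ← mul_assoc]
    have hx : 1 / ((n : ℝ) + 2) < 1 := by rw [div_lt_one hn2]; linarith
    have hx0 : 0 < 1 / ((n : ℝ) + 2) := by positivity
    have h2 := rpow_one_add_le_one_add_mul_self
      (s := -(1 / ((n : ℝ) + 2))) (by linarith) hα.le hα'
    have e3 : (α + (((n + 1 : ℕ) : ℝ) + 1)) / (((n + 1 : ℕ) : ℝ) + 1)
        = 1 + α * (1 / ((n : ℝ) + 2)) := by
      push_cast
      have : (n : ℝ) + 1 + 1 = n + 2 := by ring
      rw [this]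
      field_simp
      ring
    refine mul_le_mul ih ?_ (by positivity) (by positivity)
    rw [e3]
    set x := 1 / ((n : ℝ) + 2)
    have hp : 0 < (1 + -x) ^ α := Real.rpow_pos_of_pos (by linarith) _
    rw [le_inv_comm₀ (by positivity) hp]
    refine h2.trans ?_
    rw [← one_div, le_div_iff₀ (by positivity)]
    nlinarith [sq_nonneg (α * x)]

/-! ### Weights and the scale of the normalisation -/

/-- The weights of the `(C,α,β)`-mean. -/
noncomputable def cesaroWeight (α β : ℝ) (t p : ℕ × ℕ) : ℝ :=
  cesaroNumber (α - 1) (t.1 - p.1) * cesaroNumber (β - 1) (t.2 - p.2) /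
    (cesaroNumber α t.1 * cesaroNumber β t.2)

/-- The rectangle of indices over which the `(C,α,β)`-mean is taken. -/
def rectangle (t : ℕ × ℕ) : Finset (ℕ × ℕ) := Finset.range (t.1 + 1) ×ˢ Finset.range (t.2 + 1)

theorem mem_rectangle {t p : ℕ × ℕ} : p ∈ rectangle t ↔ p.1 ≤ t.1 ∧ p.2 ≤ t.2 := by
  simp [rectangle]

theorem cesaroMean_eq_sum (α β : ℝ) (x : ℕ → ℕ → ℝ) (t : ℕ × ℕ) :
    cesaroMean α β x t.1 t.2 = ∑ p ∈ rectangle t, cesaroWeight α β t p * x p.1 p.2 := by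
  unfold cesaroMean rectangle cesaroWeight
  rw [Finset.sum_product, Finset.mul_sum]
  refine Finset.sum_congr rfl fun k _ => ?_
  rw [Finset.mul_sum]
  refine Finset.sum_congr rfl fun l _ => ?_
  ring

/-- The order of magnitude `(k+1)^α (l+1)^β` of the normalisation. -/
noncomputable def scale (α β : ℝ) (p : ℕ × ℕ) : ℝ := ((p.1 : ℝ) + 1) ^ α * ((p.2 : ℝ) + 1) ^ β

theorem scale_pos (α β : ℝ) (p : ℕ × ℕ) : 0 < scale α β p := by
  unfold scale; positivity

theorem scale_mono {α β : ℝ} (hα : 0 ≤ α) (hβ : 0 ≤ β) {p t : ℕ × ℕ} (h : p ∈ rectangle t) :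
    scale α β p ≤ scale α β t := by
  rw [mem_rectangle] at h
  unfold scale
  have h1 : (p.1 : ℝ) ≤ t.1 := by exact_mod_cast h.1
  have h2 : (p.2 : ℝ) ≤ t.2 := by exact_mod_cast h.2
  gcongr

theorem one_le_scale {α β : ℝ} (hα : 0 ≤ α) (hβ : 0 ≤ β) (p : ℕ × ℕ) : 1 ≤ scale α β p := by
  have := scale_mono (p := (0, 0)) (t := p) hα hβ (by simp [mem_rectangle])
  simpa [scale] using this

theorem scale_le_cesaroNumber_mul {α β : ℝ} (hα : 0 < α) (hα' : α ≤ 1) (hβ : 0 < β) (hβ' : β ≤ 1)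
    (t : ℕ × ℕ) :
    scale α β t ≤ cesaroNumber α t.1 * cesaroNumber β t.2 :=
  mul_le_mul (rpow_le_cesaroNumber hα hα' _) (rpow_le_cesaroNumber hβ hβ' _) (by positivity)
    (cesaroNumber_pos (by linarith) _).le

theorem cesaroNumber_mul_le_scale {α β : ℝ} (hα : 0 < α) (hα' : α ≤ 1) (hβ : 0 < β) (hβ' : β ≤ 1)
    (t : ℕ × ℕ) :
    cesaroNumber α t.1 * cesaroNumber β t.2 ≤ 4 * scale α β t := by
  have := mul_le_mul (cesaroNumber_le_rpow hα hα' t.1) (cesaroNumber_le_rpow hβ hβ' t.2)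
    (cesaroNumber_pos (by linarith) _).le (by positivity)
  unfold scale
  linarith

theorem cesaroWeight_nonneg {α β : ℝ} (hα : 0 < α) (hβ : 0 < β) (t p : ℕ × ℕ) : 0 ≤ cesaroWeight α β t p := by
  have h1 := cesaroNumber_pos (α := α - 1) (by linarith) (t.1 - p.1)
  have h2 := cesaroNumber_pos (α := β - 1) (by linarith) (t.2 - p.2)
  have h3 := cesaroNumber_pos (α := α) (by linarith) t.1
  have h4 := cesaroNumber_pos (α := β) (by linarith) t.2
  unfold cesaroWeight
  positivity

/-- Since `-1 < α - 1 ≤ 0`, and likewise for `β`, the numerators are at most one. This also holds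
off the rectangle, where natural subtraction truncates to zero. -/
theorem cesaroWeight_le {α β : ℝ} (hα : 0 < α) (hα' : α ≤ 1) (hβ : 0 < β) (hβ' : β ≤ 1)
    (t p : ℕ × ℕ) : cesaroWeight α β t p ≤ (scale α β t)⁻¹ := by
  have h1 := cesaroNumber_le_one (α := α - 1) (by linarith) (by linarith) (t.1 - p.1)
  have h2 := cesaroNumber_le_one (α := β - 1) (by linarith) (by linarith) (t.2 - p.2)
  have h2' := cesaroNumber_pos (α := β - 1) (by linarith) (t.2 - p.2)
  have h3 := scale_le_cesaroNumber_mul hα hα' hβ hβ' t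
  unfold cesaroWeight
  rw [← one_div]
  exact div_le_div₀ zero_le_one (mul_le_one₀ h1 h2'.le h2) (scale_pos _ _ _) h3

theorem sum_cesaroWeight {α β : ℝ} (hα : 0 < α) (hβ : 0 < β) 
    (t : ℕ × ℕ) : ∑ p ∈ rectangle t, cesaroWeight α β t p = 1 := by
  have h3 := cesaroNumber_pos (α := α) (by linarith) t.1
  have h4 := cesaroNumber_pos (α := β) (by linarith) t.2
  unfold cesaroWeight rectangle
  rw [← Finset.sum_div, Finset.sum_product]
  simp_rw [← Finset.mul_sum]
  rw [← Finset.sum_mul, sum_cesaroNumber_reflect, sum_cesaroNumber_reflect]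
  exact div_self (by positivity)

theorem cesaroWeight_self (α β : ℝ) (t : ℕ × ℕ) :
    cesaroWeight α β t t = (cesaroNumber α t.1 * cesaroNumber β t.2)⁻¹ := by
  simp [cesaroWeight, cesaroNumber_zero_right]

/-- The exponent `2 / α` turns the scale into at least `(k+1)^2 (l+1)^2`. This is the polynomial
smallness of the weights that the exponential bound is later played against. -/
theorem summable_inv_scale_rpow {α β : ℝ} (hα : 0 < α) (hαβ : α ≤ β) :
    Summable fun t : ℕ × ℕ => ((scale α β t)⁻¹) ^ (2 / α) := by
  have h1 : Summable fun n : ℕ => (((n : ℝ) + 1) ^ (2 : ℝ))⁻¹ := by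
    have := (summable_nat_add_iff 1).2 (Real.summable_nat_rpow_inv (p := 2) |>.2 (by norm_num))
    simpa using this
  refine Summable.of_nonneg_of_le (fun t => ?_) (fun t => ?_)
    (h1.mul_of_nonneg h1 (fun _ => by positivity) (fun _ => by positivity))
  · have := scale_pos α β t
    positivity
  · rw [Real.inv_rpow (scale_pos _ _ _).le, ← mul_inv]
    refine inv_anti₀ (by positivity) ?_
    unfold scale
    rw [Real.mul_rpow (by positivity) (by positivity), ← Real.rpow_mul (by positivity),
      ← Real.rpow_mul (by positivity)]
    have e : α * (2 / α) = 2 := by field_simp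
    rw [e]
    refine mul_le_mul_of_nonneg_left ?_ (by positivity)
    refine Real.rpow_le_rpow_of_exponent_le (by simp) ?_
    calc (2 : ℝ) = α * (2 / α) := e.symm
      _ ≤ β * (2 / α) := mul_le_mul_of_nonneg_right hαβ (by positivity)

/-! ### Counting pairs, and the moment condition as a series of tail probabilities -/

theorem one_le_logPlus (x : ℝ) : 1 ≤ logPlus x := le_max_right _ _

theorem measurable_logPlus : Measurable logPlus :=
  Real.measurable_log.max measurable_const

theorem logPlus_div_le {x ε : ℝ} (hx : 0 ≤ x) (hε : 0 < ε) :
    logPlus (x / ε) ≤ (1 + |Real.log ε|) * logPlus x := by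
  have h1 := one_le_logPlus x
  have h0 := abs_nonneg (Real.log ε)
  refine max_le ?_ (by nlinarith)
  rcases hx.eq_or_lt with rfl | hx
  · simp; positivity
  · rw [Real.log_div hx.ne' hε.ne']
    have h2 : Real.log x ≤ logPlus x := le_max_left _ _
    have h3 := neg_abs_le (Real.log ε)
    nlinarith

/-- The natural subtraction also covers `z ≤ 0`, where both sides vanish. -/
theorem tsum_ite_add_one_lt (z : ℝ) :
    ∑' k : ℕ, (if (k : ℝ) + 1 < z then (1 : ℝ≥0∞) else 0) = ((⌈z⌉₊ - 1 : ℕ) : ℝ≥0∞) := by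
  have h : ∀ k : ℕ, ((k : ℝ) + 1 < z) ↔ k ∈ Finset.range (⌈z⌉₊ - 1) := by
    intro k
    have : (k : ℝ) + 1 = ((k + 1 : ℕ) : ℝ) := by push_cast; ring
    rw [this, ← Nat.lt_ceil, Finset.mem_range]
    omega
  rw [tsum_eq_sum (s := Finset.range (⌈z⌉₊ - 1))]
  · rw [Finset.sum_congr rfl fun k hk => if_pos ((h k).2 hk)]
    simp
  · intro k hk
    exact if_neg fun h' => hk ((h k).1 h')

theorem tsum_ite_add_one_lt_le (z : ℝ) :
    ∑' k : ℕ, (if (k : ℝ) + 1 < z then (1 : ℝ≥0∞) else 0) ≤ ENNReal.ofReal z := by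
  rw [tsum_ite_add_one_lt]
  rcases le_or_gt z 0 with hz | hz
  · simp [Nat.ceil_eq_zero.2 hz]
  · rw [← ENNReal.ofReal_natCast]
    refine ENNReal.ofReal_le_ofReal ?_
    have h1 : 0 < ⌈z⌉₊ := Nat.ceil_pos.2 hz
    have h2 := Nat.ceil_lt_add_one hz.le
    rw [Nat.cast_sub h1]
    push_cast
    linarith

theorem ofReal_le_tsum_ite_add_one_lt (z : ℝ) :
    ENNReal.ofReal z ≤ ∑' k : ℕ, (if (k : ℝ) + 1 < z then (1 : ℝ≥0∞) else 0) + 1 := by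
  rw [tsum_ite_add_one_lt]
  have h1 := Nat.le_ceil z
  calc ENNReal.ofReal z ≤ ENNReal.ofReal ((⌈z⌉₊ : ℕ) : ℝ) := ENNReal.ofReal_le_ofReal h1
    _ = ((⌈z⌉₊ : ℕ) : ℝ≥0∞) := ENNReal.ofReal_natCast _
    _ ≤ (((⌈z⌉₊ - 1) + 1 : ℕ) : ℝ≥0∞) := by exact_mod_cast (by omega)
    _ = _ := by push_cast; rfl

/-- The number of pairs `(k,l)` with `(k+1)(l+1)^b < z`. -/
noncomputable def pairCount (b z : ℝ) : ℝ≥0∞ :=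
  ∑' l : ℕ, ∑' k : ℕ, if (k : ℝ) + 1 < z / ((l : ℝ) + 1) ^ b then (1 : ℝ≥0∞) else 0

/-- Row `l` holds at most `z / (l+1)^b` pairs, and these bounds are summable. -/
theorem pairCount_le_of_one_lt {b : ℝ} (hb : 1 < b) :
    ∃ C : ℝ, 0 ≤ C ∧ ∀ z : ℝ, 0 ≤ z → pairCount b z ≤ ENNReal.ofReal (C * z) := by
  have hs : Summable fun n : ℕ => (((n : ℝ) + 1) ^ b)⁻¹ := by
    have := (summable_nat_add_iff 1).2 (Real.summable_nat_rpow_inv (p := b) |>.2 hb)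
    simpa using this
  refine ⟨∑' n : ℕ, (((n : ℝ) + 1) ^ b)⁻¹, tsum_nonneg fun n => by positivity, fun z hz => ?_⟩
  rw [← tsum_mul_right, ENNReal.ofReal_tsum_of_nonneg (fun n => by positivity) (hs.mul_right z)]
  refine ENNReal.tsum_le_tsum fun l => (tsum_ite_add_one_lt_le _).trans (le_of_eq ?_)
  rw [div_eq_inv_mul]

theorem one_lt_div_add_one_iff {l : ℕ} {z : ℝ} :
    1 < z / ((l : ℝ) + 1) ^ (1 : ℝ) ↔ l ∈ Finset.range (⌈z⌉₊ - 1) := by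
  rw [Real.rpow_one, one_lt_div (by positivity)]
  have : (l : ℝ) + 1 = ((l + 1 : ℕ) : ℝ) := by push_cast; ring
  rw [this, ← Nat.lt_ceil, Finset.mem_range]
  omega

/-- Only rows with `l + 1 < z` are nonempty, so the row bounds `z / (l+1)` add up to a harmonic sum.
-/
theorem pairCount_one_le {z : ℝ} (hz : 0 ≤ z) :
    pairCount 1 z ≤ ENNReal.ofReal (z * (1 + max (Real.log z) 0)) := by
  unfold pairCount
  rw [tsum_eq_sum (s := Finset.range (⌈z⌉₊ - 1))]
  · calc _ ≤ ∑ l ∈ Finset.range (⌈z⌉₊ - 1), ENNReal.ofReal (z / ((l : ℝ) + 1) ^ (1 : ℝ)) :=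
          Finset.sum_le_sum fun l _ => tsum_ite_add_one_lt_le _
      _ = ENNReal.ofReal (∑ l ∈ Finset.range (⌈z⌉₊ - 1), z / ((l : ℝ) + 1) ^ (1 : ℝ)) :=
          (ENNReal.ofReal_sum_of_nonneg fun l _ => by positivity).symm
      _ ≤ _ := by
        refine ENNReal.ofReal_le_ofReal ?_
        have h1 : ∑ l ∈ Finset.range (⌈z⌉₊ - 1), z / ((l : ℝ) + 1) ^ (1 : ℝ)
            = z * (harmonic (⌈z⌉₊ - 1) : ℝ) := by
          simp [harmonic, Finset.mul_sum, div_eq_mul_inv]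
        rw [h1]
        refine mul_le_mul_of_nonneg_left ?_ hz
        refine (harmonic_le_one_add_log _).trans ?_
        gcongr
        rcases Nat.eq_zero_or_pos (⌈z⌉₊ - 1) with h | h
        · simp [h]
        · refine le_max_of_le_left (Real.log_le_log (by exact_mod_cast h) ?_)
          have h2 := Nat.ceil_lt_add_one hz
          rw [Nat.cast_sub (by omega)]
          push_cast
          linarith
  · intro l hl
    refine ENNReal.tsum_eq_zero.2 fun k => if_neg fun h => hl ?_
    refine one_lt_div_add_one_iff.1 (lt_of_le_of_lt ?_ h)
    simp

/-- Rounding loses at most one pair in each of at most `z` nonempty rows; this is the extra summand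
`z`. -/
theorem le_pairCount_one {z : ℝ} (hz0 : 0 ≤ z) :
    ENNReal.ofReal (z * Real.log z) ≤ pairCount 1 z + ENNReal.ofReal z := by
  rcases le_or_gt z 1 with hz1 | hz
  · rw [ENNReal.ofReal_of_nonpos (mul_nonpos_of_nonneg_of_nonpos hz0 (Real.log_nonpos hz0 hz1))]
    positivity
  have hc : 1 < ⌈z⌉₊ := Nat.lt_ceil.2 (by simpa using hz)
  set n := ⌈z⌉₊ - 1 with hn
  have hnz : (n : ℝ) ≤ z := by
    have h2 := Nat.ceil_lt_add_one (a := z) (by linarith)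
    rw [hn, Nat.cast_sub (by omega)]
    push_cast
    linarith
  have h1 : z * Real.log z ≤ ∑ l ∈ Finset.range n, z / ((l : ℝ) + 1) ^ (1 : ℝ) := by
    have h1 : ∑ l ∈ Finset.range n, z / ((l : ℝ) + 1) ^ (1 : ℝ) = z * (harmonic n : ℝ) := by
      simp [harmonic, Finset.mul_sum, div_eq_mul_inv]
    rw [h1]
    refine mul_le_mul_of_nonneg_left ?_ (by linarith)
    refine le_trans (Real.log_le_log (by linarith) ?_) (log_add_one_le_harmonic n)
    have : n + 1 = ⌈z⌉₊ := by omega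
    rw [this]
    exact Nat.le_ceil z
  calc ENNReal.ofReal (z * Real.log z)
      ≤ ENNReal.ofReal (∑ l ∈ Finset.range n, z / ((l : ℝ) + 1) ^ (1 : ℝ)) :=
        ENNReal.ofReal_le_ofReal h1
    _ = ∑ l ∈ Finset.range n, ENNReal.ofReal (z / ((l : ℝ) + 1) ^ (1 : ℝ)) :=
        ENNReal.ofReal_sum_of_nonneg fun l _ => by positivity
    _ ≤ ∑ l ∈ Finset.range n, (∑' k : ℕ, (if (k : ℝ) + 1 < z / ((l : ℝ) + 1) ^ (1 : ℝ)
          then (1 : ℝ≥0∞) else 0) + 1) :=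
        Finset.sum_le_sum fun l _ => ofReal_le_tsum_ite_add_one_lt _
    _ = ∑ l ∈ Finset.range n, (∑' k : ℕ, (if (k : ℝ) + 1 < z / ((l : ℝ) + 1) ^ (1 : ℝ)
          then (1 : ℝ≥0∞) else 0)) + n := by
        rw [Finset.sum_add_distrib]; simp
    _ ≤ _ := by
        gcongr
        · exact ENNReal.sum_le_tsum _
        · rw [← ENNReal.ofReal_natCast]
          exact ENNReal.ofReal_le_ofReal hnz

/-- The row `l = 0` suffices. -/
theorem ofReal_le_pairCount (b z : ℝ) : ENNReal.ofReal z ≤ pairCount b z + 1 := by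
  refine (ofReal_le_tsum_ite_add_one_lt z).trans ?_
  gcongr
  refine le_trans (le_of_eq ?_) (ENNReal.le_tsum 0)
  simp

theorem scale_lt_iff {α β y : ℝ} (hα : 0 < α) (hy : 0 ≤ y) (k l : ℕ) :
    scale α β (k, l) < y ↔ (k : ℝ) + 1 < y ^ (1 / α) / ((l : ℝ) + 1) ^ (β / α) := by
  have h1 : ((l : ℝ) + 1) ^ (β / α) = (((l : ℝ) + 1) ^ β) ^ (1 / α) := by
    rw [← Real.rpow_mul (by positivity)]
    congr 1
    ring
  have h2 : (k : ℝ) + 1 = (((k : ℝ) + 1) ^ α) ^ (1 / α) := by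
    rw [← Real.rpow_mul (by positivity), mul_one_div_cancel hα.ne', Real.rpow_one]
  rw [lt_div_iff₀ (by positivity), h1]
  conv_rhs => rw [h2]
  rw [← Real.mul_rpow (by positivity) (by positivity),
    Real.rpow_lt_rpow_iff (by positivity) hy (by positivity)]
  rfl

/-- Tonelli: summing the tail probabilities over all pairs integrates the number of pairs below the
value of `f`. -/
theorem tsum_measure_scale_lt {Ω : Type*} [MeasurableSpace Ω] (ν : Measure Ω) {f : Ω → ℝ}
    (hf : Measurable f) (hf0 : 0 ≤ f) {α : ℝ} (β : ℝ) (hα : 0 < α) :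
    ∑' p : ℕ × ℕ, ν {ω | scale α β p < f ω} = ∫⁻ ω, pairCount (β / α) (f ω ^ (1 / α)) ∂ν := by
  have hm : ∀ l k : ℕ, MeasurableSet
      {ω | (k : ℝ) + 1 < f ω ^ (1 / α) / ((l : ℝ) + 1) ^ (β / α)} := fun l k =>
    measurableSet_lt measurable_const ((hf.pow_const _).div_const _)
  have hm' : ∀ l k : ℕ, Measurable fun ω =>
      if (k : ℝ) + 1 < f ω ^ (1 / α) / ((l : ℝ) + 1) ^ (β / α) then (1 : ℝ≥0∞) else 0 :=
    fun l k => Measurable.ite (hm l k) measurable_const measurable_const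
  unfold pairCount
  rw [lintegral_tsum fun l => (Measurable.tsum (hm' l)).aemeasurable,
    ENNReal.tsum_prod', ENNReal.tsum_comm]
  refine tsum_congr fun l => ?_
  rw [lintegral_tsum fun k => (hm' l k).aemeasurable]
  refine tsum_congr fun k => ?_
  have h1 : {ω | scale α β (k, l) < f ω}
      = {ω | (k : ℝ) + 1 < f ω ^ (1 / α) / ((l : ℝ) + 1) ^ (β / α)} := by
    ext ω
    exact scale_lt_iff hα (hf0 ω) k l
  rw [h1, ← lintegral_indicator_one (hm l k)]
  rfl

theorem tsum_measure_lt_abs {Ω : Type*} [MeasurableSpace Ω] (ν : Measure Ω) {f : Ω → ℝ}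
    (hf : Measurable f) {α : ℝ} (β : ℝ) (hα : 0 < α) {ε : ℝ} (hε : 0 < ε) :
    ∑' p : ℕ × ℕ, ν {ω | ε * scale α β p < |f ω|}
      = ∫⁻ ω, pairCount (β / α) ((|f ω| / ε) ^ (1 / α)) ∂ν := by
  rw [← tsum_measure_scale_lt ν (f := fun ω => |f ω| / ε) (hf.abs.div_const _)
    (fun ω => by simp only [Pi.zero_apply]; positivity) β hα]
  refine tsum_congr fun p => ?_
  simp_rw [lt_div_iff₀ hε, mul_comm ε]

/-- The moment condition: `E|f|^{1/α} < ∞` when `α < β` and `E|f|^{1/α} log⁺|f| < ∞` when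
`α = β`. -/
def MomentCondition {Ω : Type*} [MeasurableSpace Ω] (ν : Measure Ω) (α β : ℝ) (f : Ω → ℝ) : Prop :=
  (α < β → Integrable (fun ω => |f ω| ^ (1 / α)) ν) ∧
    (α = β → Integrable (fun ω => |f ω| ^ (1 / α) * logPlus |f ω|) ν)

theorem MomentCondition.integrable_rpow {Ω : Type*} [MeasurableSpace Ω] {ν : Measure Ω}
    {α β : ℝ} (hαβ : α ≤ β) {f : Ω → ℝ} (hf : AEMeasurable f ν) (h : MomentCondition ν α β f) :
    Integrable (fun ω => |f ω| ^ (1 / α)) ν := by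
  rcases hαβ.lt_or_eq with hlt | heq
  · exact h.1 hlt
  · refine (h.2 heq).mono (hf.abs.pow_const _).aestronglyMeasurable (.of_forall fun ω => ?_)
    have h1 := one_le_logPlus |f ω|
    have h2 : 0 ≤ |f ω| ^ (1 / α) := by positivity
    rw [Real.norm_of_nonneg h2, Real.norm_of_nonneg (by positivity)]
    exact le_mul_of_one_le_right h2 h1

theorem MomentCondition.tsum_measure_ne_top {Ω : Type*} [MeasurableSpace Ω] {ν : Measure Ω}
    {α β : ℝ} (hα : 0 < α) (hαβ : α ≤ β) {f : Ω → ℝ} (hf : Measurable f)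
    (h : MomentCondition ν α β f) {ε : ℝ} (hε : 0 < ε) :
    ∑' p : ℕ × ℕ, ν {ω | ε * scale α β p < |f ω|} ≠ ∞ := by
  rw [tsum_measure_lt_abs ν hf β hα hε]
  rcases hαβ.lt_or_eq with hlt | heq
  · obtain ⟨C, -, hC⟩ := pairCount_le_of_one_lt ((one_lt_div hα).2 hlt)
    refine ne_top_of_le_ne_top ?_ (lintegral_mono fun ω => hC _ (by positivity))
    refine Integrable.lintegral_lt_top ?_ |>.ne
    refine (((h.1 hlt).div_const (ε ^ (1 / α))).const_mul C).congr (.of_forall fun ω => ?_)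
    simp only
    rw [Real.div_rpow (abs_nonneg _) hε.le]
  · subst heq
    rw [div_self hα.ne']
    refine ne_top_of_le_ne_top ?_ (lintegral_mono (g := fun ω => ENNReal.ofReal
      ((1 / ε ^ (1 / α) * ((1 + 1 / α) * (1 + |Real.log ε|))) *
        (|f ω| ^ (1 / α) * logPlus |f ω|))) fun ω => ?_)
    · exact ((h.2 rfl).const_mul _).lintegral_lt_top.ne
    · refine (pairCount_one_le (by positivity)).trans (ENNReal.ofReal_le_ofReal ?_)
      set y := |f ω| / ε with hy
      have hy0 : 0 ≤ y := by positivity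
      have h1 : 1 + max (Real.log (y ^ (1 / α))) 0 ≤ (1 + 1 / α) * logPlus y := by
        have h2 := one_le_logPlus y
        have h3 : Real.log (y ^ (1 / α)) ≤ 1 / α * logPlus y := by
          rcases hy0.eq_or_lt with h0 | h0
          · rw [← h0, Real.zero_rpow (by positivity), Real.log_zero]
            have := one_le_logPlus 0
            positivity
          · rw [Real.log_rpow h0]
            exact mul_le_mul_of_nonneg_left (le_max_left _ _) (by positivity)
        have h4 : max (Real.log (y ^ (1 / α))) 0 ≤ 1 / α * logPlus y :=
          max_le h3 (by positivity)
        linarith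
      calc y ^ (1 / α) * (1 + max (Real.log (y ^ (1 / α))) 0)
          ≤ y ^ (1 / α) * ((1 + 1 / α) * ((1 + |Real.log ε|) * logPlus |f ω|)) := by
            refine mul_le_mul_of_nonneg_left (h1.trans ?_) (by positivity)
            exact mul_le_mul_of_nonneg_left (logPlus_div_le (abs_nonneg _) hε) (by positivity)
        _ = _ := by
            rw [hy, Real.div_rpow (abs_nonneg _) hε.le]
            ring

theorem momentCondition_of_tsum_measure_ne_top {Ω : Type*} [MeasurableSpace Ω] {ν : Measure Ω}
    [IsFiniteMeasure ν] {α β : ℝ} (hα : 0 < α) {f : Ω → ℝ} (hf : Measurable f)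
    {C : ℝ} (hC : 0 < C) (h : ∑' p : ℕ × ℕ, ν {ω | C * scale α β p < |f ω|} ≠ ∞) :
    MomentCondition ν α β f := by
  rw [tsum_measure_lt_abs ν hf β hα hC] at h
  set z : Ω → ℝ := fun ω => (|f ω| / C) ^ (1 / α) with hz
  have hzm : Measurable z := (hf.abs.div_const _).pow_const _
  have hz0 : ∀ ω, 0 ≤ z ω := fun ω => by positivity
  have hfz : ∀ ω, |f ω| ^ (1 / α) = C ^ (1 / α) * z ω := fun ω => by
    simp only [hz]
    rw [Real.div_rpow (abs_nonneg _) hC.le]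
    field_simp
  have hzi : Integrable z ν := by
    refine ⟨hzm.aestronglyMeasurable, ?_⟩
    rw [hasFiniteIntegral_iff_ofReal (.of_forall hz0)]
    refine lt_of_le_of_lt (lintegral_mono fun ω => ofReal_le_pairCount (β / α) (z ω)) ?_
    rw [lintegral_add_right _ measurable_const]
    simp only [lintegral_one]
    exact ENNReal.add_lt_top.2 ⟨h.lt_top, measure_lt_top _ _⟩
  refine ⟨fun _ => (hzi.const_mul (C ^ (1 / α))).congr (.of_forall fun ω => (hfz ω).symm), ?_⟩
  rintro rfl
  rw [div_self hα.ne'] at h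
  -- The positive part is taken because `z log z` is negative for `0 < z < 1`.
  have hzl : Integrable (fun ω => max (z ω * Real.log (z ω)) 0) ν := by
    refine ⟨by fun_prop, ?_⟩
    rw [hasFiniteIntegral_iff_ofReal (.of_forall fun ω => by simp)]
    refine lt_of_le_of_lt (lintegral_mono (g := fun ω => pairCount 1 (z ω) + ENNReal.ofReal (z ω))
      fun ω => ?_) ?_
    · rw [ENNReal.ofReal_max]
      simpa using le_pairCount_one (hz0 ω)
    · rw [lintegral_add_right _ (by fun_prop)]
      exact ENNReal.add_lt_top.2 ⟨h.lt_top, hzi.lintegral_lt_top⟩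
  refine Integrable.mono' (((hzi.const_mul (1 + |Real.log C|)).add (hzl.const_mul α)).const_mul
    (C ^ (1 / α))) ?_ (.of_forall fun ω => ?_)
  · exact ((hf.abs.pow_const _).mul (measurable_logPlus.comp hf.abs)).aestronglyMeasurable
  · have h1 := one_le_logPlus |f ω|
    rw [Real.norm_of_nonneg (by positivity), hfz, mul_assoc]
    refine mul_le_mul_of_nonneg_left ?_ (by positivity)
    have hzw := hz0 ω
    rcases hzw.eq_or_lt with h0 | h0
    · simp [← h0]
    have h2 : |f ω| = C * z ω ^ α := by
      simp only [hz]
      rw [← Real.rpow_mul (by positivity), one_div_mul_cancel hα.ne', Real.rpow_one]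
      field_simp
    have h3 : Real.log |f ω| = Real.log C + α * Real.log (z ω) := by
      rw [h2, Real.log_mul hC.ne' (by positivity), Real.log_rpow h0]
    have h4 : z ω * Real.log |f ω| ≤ (1 + |Real.log C|) * z ω
        + α * max (z ω * Real.log (z ω)) 0 := by
      rw [h3]
      have h5 := mul_le_mul_of_nonneg_left (le_max_left (z ω * Real.log (z ω)) 0) hα.le
      have h6 := mul_le_mul_of_nonneg_left (le_abs_self (Real.log C)) h0.le
      nlinarith
    have h7 : z ω ≤ (1 + |Real.log C|) * z ω + α * max (z ω * Real.log (z ω)) 0 := by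
      have h8 : 0 ≤ |Real.log C| * z ω := by positivity
      have h9 : 0 ≤ α * max (z ω * Real.log (z ω)) 0 := by positivity
      linarith
    unfold logPlus
    rw [mul_max_of_nonneg _ _ h0.le, mul_one]
    exact max_le h4 h7

/-! ### Truncation and exponential estimates -/

/-- The truncation of `x` at level `η`: it is `x` if `|x| ≤ η`, and `0` otherwise. -/
noncomputable def cutoff (η x : ℝ) : ℝ := if |x| ≤ η then x else 0

theorem measurable_cutoff (η : ℝ) : Measurable (cutoff η) :=
  Measurable.ite (measurableSet_le measurable_id.abs measurable_const) measurable_id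
    measurable_const

theorem abs_cutoff_le {η : ℝ} (hη : 0 ≤ η) (x : ℝ) : |cutoff η x| ≤ η := by
  unfold cutoff
  split_ifs with h
  · exact h
  · simpa using hη

theorem exp_le_one_add_add_sq_mul (x : ℝ) : Real.exp x ≤ 1 + x + x ^ 2 * Real.exp |x| := by
  have h := Complex.norm_exp_sub_sum_le_norm_mul_exp (x : ℂ) 2
  have h1 : Complex.exp (x : ℂ) - ∑ m ∈ Finset.range 2, (x : ℂ) ^ m / (m.factorial : ℂ)
      = ((Real.exp x - (1 + x) : ℝ) : ℂ) := by
    simp [Finset.sum_range_succ]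
  rw [h1, Complex.norm_real, Complex.norm_real, Real.norm_eq_abs, Real.norm_eq_abs, sq_abs] at h
  linarith [le_abs_self (Real.exp x - (1 + x))]

/-- The linear term is kept untruncated so that it integrates to zero for a centred variable. Where
`|x| > η` the left side is `1`, and `c|x| ≤ c η^(1-q) |x|^q` pays for that term. -/
theorem exp_mul_cutoff_le {η q c : ℝ} (hη : 0 < η) (hq : 1 ≤ q) (hq2 : q ≤ 2) (hc : 0 ≤ c)
    (x : ℝ) : Real.exp (c * cutoff η x) ≤ 1 + c * x +
      (c * η ^ (1 - q) + c ^ 2 * Real.exp (c * η) * η ^ (2 - q)) * |x| ^ q := by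
  unfold cutoff
  split_ifs with h
  · have h1 := exp_le_one_add_add_sq_mul (c * x)
    have h2 : x ^ 2 ≤ η ^ (2 - q) * |x| ^ q := by
      rcases eq_or_ne x 0 with rfl | hx
      · rw [zero_pow two_ne_zero]; positivity
      · have hx' : 0 < |x| := abs_pos.2 hx
        calc x ^ 2 = |x| ^ (2 - q) * |x| ^ q := by
              rw [← Real.rpow_add hx', ← sq_abs]; norm_num
          _ ≤ _ := by
              gcongr
    have h3 : Real.exp |c * x| ≤ Real.exp (c * η) := by
      rw [abs_mul, abs_of_nonneg hc]
      gcongr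
    have h4 : (c * x) ^ 2 * Real.exp |c * x|
        ≤ c ^ 2 * (η ^ (2 - q) * |x| ^ q) * Real.exp (c * η) := by
      rw [mul_pow]
      gcongr
    have h5 : 0 ≤ c * η ^ (1 - q) * |x| ^ q := by positivity
    nlinarith
  · push Not at h
    have hx' : 0 < |x| := hη.trans h
    have h1 : |x| ≤ η ^ (1 - q) * |x| ^ q := by
      have : |x| ^ (1 - q) ≤ η ^ (1 - q) :=
        Real.rpow_le_rpow_of_nonpos hη h.le (by linarith)
      calc |x| = |x| ^ (1 - q) * |x| ^ q := by
            rw [← Real.rpow_add hx']; norm_num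
        _ ≤ _ := by gcongr
    have h2 := mul_le_mul_of_nonneg_left h1 hc
    have h3 := mul_le_mul_of_nonneg_left (neg_abs_le x) hc
    have h4 : 0 ≤ c ^ 2 * Real.exp (c * η) * η ^ (2 - q) * |x| ^ q := by positivity
    simp only [mul_zero, Real.exp_zero]
    nlinarith

/-- Here `e` bounds the weights and `c log(1/e)` is the exponential parameter. With `cη = (q-1)/2`
the exponential factor is `e^(-(q-1)/2)`; it uses half of `e^(q-1)`, and the other half absorbs the
squared logarithm. -/
theorem exists_truncation_cost_le {η q c : ℝ} (hη : 0 < η) (hq : 1 < q) (hc : 0 < c)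
    (hcη : c * η = (q - 1) / 2) :
    ∃ K : ℝ, ∀ e : ℝ, 0 < e → e ≤ 1 →
      (c * Real.log (1 / e) * η ^ (1 - q) + (c * Real.log (1 / e)) ^ 2 *
        Real.exp (c * Real.log (1 / e) * η) * η ^ (2 - q)) * e ^ (q - 1) ≤ K := by
  have hq0 : 0 < q - 1 := by linarith
  refine ⟨c * (1 / (q - 1)) * η ^ (1 - q) + c ^ 2 * (4 / (q - 1)) ^ 2 * η ^ (2 - q),
    fun e he he1 => ?_⟩
  set L := Real.log (1 / e) with hL
  have hL0 : 0 ≤ L := Real.log_nonneg ((one_le_div he).2 he1)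
  have key : ∀ a : ℝ, 0 < a → L * e ^ a ≤ 1 / a := by
    intro a ha
    have h1 := Real.log_le_rpow_div (x := 1 / e) (by positivity) ha
    have h2 : 0 < e ^ a := by positivity
    calc L * e ^ a ≤ (1 / e) ^ a / a * e ^ a := by gcongr
      _ = 1 / a := by
        rw [one_div, Real.inv_rpow he.le]
        field_simp
  have h1 := key (q - 1) hq0
  have h2 := key ((q - 1) / 4) (by linarith)
  have h3 : Real.exp (c * L * η) * e ^ (q - 1) = (e ^ ((q - 1) / 4)) ^ 2 := by
    rw [hL, one_div, Real.log_inv, ← Real.rpow_natCast, ← Real.rpow_mul he.le,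
      Real.rpow_def_of_pos he, Real.rpow_def_of_pos he, ← Real.exp_add]
    congr 1
    push_cast
    linear_combination (-Real.log e) * hcη
  have h4 : (L * e ^ ((q - 1) / 4)) ^ 2 ≤ (4 / (q - 1)) ^ 2 := by
    refine pow_le_pow_left₀ (by positivity) (h2.trans (le_of_eq ?_)) 2
    field_simp
  calc _ = c * (L * e ^ (q - 1)) * η ^ (1 - q)
        + c ^ 2 * (L ^ 2 * (Real.exp (c * L * η) * e ^ (q - 1))) * η ^ (2 - q) := by ring
    _ = c * (L * e ^ (q - 1)) * η ^ (1 - q)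
        + c ^ 2 * (L * e ^ ((q - 1) / 4)) ^ 2 * η ^ (2 - q) := by rw [h3]; ring
    _ ≤ _ := by gcongr

/-! ### A strong law for weighted sums -/

section
variable {Ω ι : Type*} [MeasurableSpace Ω] {P : Measure Ω} [IsProbabilityMeasure P] {q M : ℝ}

theorem mgf_cutoff_le {X : Ω → ℝ} (hXi : Integrable X P)
    (hX0 : ∫ ω, X ω ∂P = 0) (hq : 1 ≤ q) (hq2 : q ≤ 2)
    (hXq : Integrable (fun ω => |X ω| ^ q) P) (hM : ∫ ω, |X ω| ^ q ∂P ≤ M)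
    {η c w : ℝ} (hη : 0 < η) (hc : 0 ≤ c) (hw : 0 ≤ w) :
    mgf (fun ω => cutoff η (w * X ω)) P c ≤
      Real.exp ((c * η ^ (1 - q) + c ^ 2 * Real.exp (c * η) * η ^ (2 - q)) * (w ^ q * M)) := by
  set D := c * η ^ (1 - q) + c ^ 2 * Real.exp (c * η) * η ^ (2 - q) with hD
  have hD0 : 0 ≤ D := by positivity
  refine le_trans ?_ (Real.add_one_le_exp _)
  calc mgf (fun ω => cutoff η (w * X ω)) P c
      ≤ ∫ ω, (1 + c * w * X ω + D * w ^ q * |X ω| ^ q) ∂P := by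
        refine integral_mono_of_nonneg (.of_forall fun ω => (Real.exp_pos _).le) ?_
          (.of_forall fun ω => ?_)
        · exact ((integrable_const _).add (hXi.const_mul _)).add (hXq.const_mul _)
        · refine (exp_mul_cutoff_le hη hq hq2 hc (w * X ω)).trans (le_of_eq ?_)
          rw [abs_mul, abs_of_nonneg hw, Real.mul_rpow hw (abs_nonneg _)]
          ring
    _ = 1 + D * w ^ q * ∫ ω, |X ω| ^ q ∂P := by
        have hA : Integrable (fun ω => 1 + c * w * X ω) P :=
          (integrable_const _).add (hXi.const_mul _)
        rw [integral_add hA (hXq.const_mul _),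
          integral_add (integrable_const _) (hXi.const_mul _), integral_const_mul,
          integral_const_mul, hX0]
        simp
    _ ≤ D * (w ^ q * M) + 1 := by
        have := mul_le_mul_of_nonneg_left hM (show 0 ≤ D * w ^ q by positivity)
        linarith

/-- Chernoff's bound for independent summands, combined with `∑ w_i^q ≤ e^(q-1) ∑ w_i ≤ e^(q-1)`. -/
theorem measure_sum_cutoff_ge_le {X : ι → Ω → ℝ} (hX : ∀ i, Measurable (X i))
    (hindep : iIndepFun X P) (hXi : ∀ i, Integrable (X i) P) (hX0 : ∀ i, ∫ ω, X i ω ∂P = 0)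
    (hq : 1 ≤ q) (hq2 : q ≤ 2) (hXq : ∀ i, Integrable (fun ω => |X i ω| ^ q) P)
    (hM : ∀ i, ∫ ω, |X i ω| ^ q ∂P ≤ M) (hM0 : 0 ≤ M) {η c e ε : ℝ} (hη : 0 < η) (hc : 0 ≤ c)
    (he : 0 < e)
    (s : Finset ι) {w : ι → ℝ} (hw : ∀ i ∈ s, 0 ≤ w i) (hwe : ∀ i ∈ s, w i ≤ e)
    (hw1 : ∑ i ∈ s, w i ≤ 1) :
    P.real {ω | ε ≤ ∑ i ∈ s, cutoff η (w i * X i ω)} ≤ Real.exp (-c * ε) *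
      Real.exp ((c * η ^ (1 - q) + c ^ 2 * Real.exp (c * η) * η ^ (2 - q)) * e ^ (q - 1) * M) := by
  set D := c * η ^ (1 - q) + c ^ 2 * Real.exp (c * η) * η ^ (2 - q) with hD
  have hD0 : 0 ≤ D := by positivity
  set Z : ι → Ω → ℝ := fun i ω => cutoff η (w i * X i ω) with hZ
  have hZm : ∀ i, Measurable (Z i) := fun i =>
    (measurable_cutoff η).comp ((hX i).const_mul (w i))
  have hZi : iIndepFun Z P :=
    hindep.comp (fun i x => cutoff η (w i * x))
      fun i => (measurable_cutoff η).comp (measurable_const_mul (w i))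
  have hint : Integrable (fun ω => Real.exp (c * (∑ i ∈ s, Z i) ω)) P := by
    refine Integrable.of_bound (C := Real.exp (c * (s.card * η))) (by fun_prop)
      (.of_forall fun ω => ?_)
    rw [Real.norm_of_nonneg (Real.exp_pos _).le]
    have : (∑ i ∈ s, Z i) ω ≤ s.card * η := by
      rw [Finset.sum_apply, ← nsmul_eq_mul]
      exact Finset.sum_le_card_nsmul _ _ _ fun i _ =>
        (le_abs_self _).trans (abs_cutoff_le hη.le _)
    gcongr
  have h1 := measure_ge_le_exp_mul_mgf (μ := P) (X := ∑ i ∈ s, Z i) ε hc hint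
  simp only [Finset.sum_apply] at h1
  refine h1.trans (mul_le_mul_of_nonneg_left ?_ (Real.exp_pos _).le)
  rw [hZi.mgf_sum hZm]
  calc ∏ i ∈ s, mgf (Z i) P c ≤ ∏ i ∈ s, Real.exp (D * (w i ^ q * M)) :=
        Finset.prod_le_prod (fun i _ => mgf_nonneg) fun i hi =>
          mgf_cutoff_le (hXi i) (hX0 i) hq hq2 (hXq i) (hM i) hη hc (hw i hi)
    _ = Real.exp (D * ((∑ i ∈ s, w i ^ q) * M)) := by
        rw [← Real.exp_sum, ← Finset.mul_sum, ← Finset.sum_mul]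
    _ ≤ _ := by
        rw [Real.exp_le_exp, mul_assoc]
        refine mul_le_mul_of_nonneg_left (mul_le_mul_of_nonneg_right ?_ hM0) hD0
        calc ∑ i ∈ s, w i ^ q ≤ ∑ i ∈ s, e ^ (q - 1) * w i := by
              refine Finset.sum_le_sum fun i hi => ?_
              rcases (hw i hi).eq_or_lt with h0 | h0
              · rw [← h0, Real.zero_rpow (by linarith), mul_zero]
              · calc w i ^ q = w i ^ (q - 1) * w i := by
                      rw [← Real.rpow_add_one h0.ne']; norm_num
                  _ ≤ _ := by
                      exact mul_le_mul_of_nonneg_right (Real.rpow_le_rpow h0.le (hwe i hi)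
                        (by linarith)) h0.le
          _ ≤ e ^ (q - 1) := by
              rw [← Finset.mul_sum]
              exact mul_le_of_le_one_right (by positivity) hw1

variable {T : Type*} [Countable T]

theorem ae_eventually_weighted_sum_lt {X : ι → Ω → ℝ} (hX : ∀ i, Measurable (X i))
    (hindep : iIndepFun X P) (hXi : ∀ i, Integrable (X i) P) (hX0 : ∀ i, ∫ ω, X i ω ∂P = 0)
    (hq : 1 < q) (hq2 : q ≤ 2) (hXq : ∀ i, Integrable (fun ω => |X i ω| ^ q) P)
    (hM : ∀ i, ∫ ω, |X i ω| ^ q ∂P ≤ M) (hM0 : 0 ≤ M)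
    (s : T → Finset ι) {w : T → ι → ℝ} {e : T → ℝ} (hw : ∀ t, ∀ i ∈ s t, 0 ≤ w t i)
    (hw1 : ∀ t, ∑ i ∈ s t, w t i ≤ 1) (hwe : ∀ t, ∀ i ∈ s t, w t i ≤ e t) (he : ∀ t, 0 < e t)
    (he1 : ∀ t, e t ≤ 1) {r : ℝ} (hr : 0 < r) (her : Summable fun t => e t ^ r)
    (hmax : ∀ η : ℝ, 0 < η → ∀ᵐ ω ∂P, ∀ᶠ t in cofinite, ∀ i ∈ s t, w t i * |X i ω| ≤ η)
    {ε : ℝ} (hε : 0 < ε) :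
    ∀ᵐ ω ∂P, ∀ᶠ t in cofinite, ∑ i ∈ s t, w t i * X i ω < ε := by
  -- With the parameter `c log(1/e)`, the Markov factor at level `ε` is exactly `e^r`, which is
  -- summable. The level `η` is then forced by `cη = (q-1)/2`.
  set c := r / ε with hc
  have hc0 : 0 < c := by positivity
  set η := (q - 1) / 2 / c with hη
  have hη0 : 0 < η := div_pos (by linarith) hc0
  obtain ⟨K, hK⟩ := exists_truncation_cost_le hη0 hq hc0 (by rw [hη]; field_simp)
  have hbound : ∀ t, P {ω | ε ≤ ∑ i ∈ s t, cutoff η (w t i * X i ω)} ≤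
      ENNReal.ofReal (e t ^ r * Real.exp (K * M)) := by
    intro t
    have hL0 : 0 ≤ Real.log (1 / e t) := Real.log_nonneg ((one_le_div (he t)).2 (he1 t))
    have h := measure_sum_cutoff_ge_le hX hindep hXi hX0 hq.le hq2 hXq hM hM0 (ε := ε) hη0
      (mul_nonneg hc0.le hL0) (he t) (s t) (hw t) (hwe t) (hw1 t)
    rw [← ofReal_measureReal]
    refine ENNReal.ofReal_le_ofReal (h.trans ?_)
    have h2 : Real.exp (-(c * Real.log (1 / e t)) * ε) = e t ^ r := by
      rw [Real.rpow_def_of_pos (he t), one_div, Real.log_inv, hc]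
      congr 1
      field_simp
    rw [h2]
    have := (he t).le
    have h3 := mul_le_mul_of_nonneg_right (hK (e t) (he t) (he1 t)) hM0
    gcongr
  have hsum : ∑' t, P {ω | ε ≤ ∑ i ∈ s t, cutoff η (w t i * X i ω)} ≠ ∞ := by
    refine ne_top_of_le_ne_top ?_ (ENNReal.tsum_le_tsum hbound)
    exact (her.mul_right _).tsum_ofReal_ne_top
  filter_upwards [ae_finite_setOfPred_mem hsum, hmax η hη0] with ω h1 h2
  filter_upwards [h1.compl_mem_cofinite, h2] with t ht1 ht2
  have h3 : ¬ ε ≤ ∑ i ∈ s t, cutoff η (w t i * X i ω) := ht1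
  push Not at h3
  -- No term exceeds `η` any more, so the truncated sum is the sum itself.
  refine lt_of_eq_of_lt (Finset.sum_congr rfl fun i hi => ?_) h3
  rw [cutoff, if_pos]
  rw [abs_mul, abs_of_nonneg (hw t i hi)]
  exact ht2 i hi

/-- A strong law for weighted sums of independent centred variables with bounded `q`-th moments,
`1 < q ≤ 2`, whose weights are polynomially small and whose largest term vanishes. -/
theorem ae_tendsto_weighted_sum {X : ι → Ω → ℝ} (hX : ∀ i, Measurable (X i))
    (hindep : iIndepFun X P) (hXi : ∀ i, Integrable (X i) P) (hX0 : ∀ i, ∫ ω, X i ω ∂P = 0)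
    (hq : 1 < q) (hq2 : q ≤ 2) (hXq : ∀ i, Integrable (fun ω => |X i ω| ^ q) P)
    (hM : ∀ i, ∫ ω, |X i ω| ^ q ∂P ≤ M) (hM0 : 0 ≤ M)
    (s : T → Finset ι) {w : T → ι → ℝ} {e : T → ℝ} (hw : ∀ t, ∀ i ∈ s t, 0 ≤ w t i)
    (hw1 : ∀ t, ∑ i ∈ s t, w t i ≤ 1) (hwe : ∀ t, ∀ i ∈ s t, w t i ≤ e t) (he : ∀ t, 0 < e t)
    (he1 : ∀ t, e t ≤ 1) {r : ℝ} (hr : 0 < r) (her : Summable fun t => e t ^ r)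
    (hmax : ∀ η : ℝ, 0 < η → ∀ᵐ ω ∂P, ∀ᶠ t in cofinite, ∀ i ∈ s t, w t i * |X i ω| ≤ η) :
    ∀ᵐ ω ∂P, Tendsto (fun t => ∑ i ∈ s t, w t i * X i ω) cofinite (𝓝 0) := by
  have hup : ∀ n : ℕ, ∀ᵐ ω ∂P, ∀ᶠ t in cofinite,
      ∑ i ∈ s t, w t i * X i ω < 1 / ((n : ℝ) + 1) := fun n =>
    ae_eventually_weighted_sum_lt hX hindep hXi hX0 hq hq2 hXq hM hM0 s hw hw1 hwe he he1 hr her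
      hmax (by positivity)
  have hdown : ∀ n : ℕ, ∀ᵐ ω ∂P, ∀ᶠ t in cofinite,
      ∑ i ∈ s t, w t i * -X i ω < 1 / ((n : ℝ) + 1) := fun n =>
    ae_eventually_weighted_sum_lt (X := fun i ω => -X i ω) (fun i => (hX i).neg)
      (hindep.comp (fun _ x => -x) fun _ => measurable_neg) (fun i => (hXi i).neg)
      (fun i => by rw [integral_neg, hX0, neg_zero]) hq hq2
      (by simpa using hXq) (by simpa using hM) hM0 s hw hw1 hwe he he1 hr her
      (by simpa using hmax) (by positivity)
  filter_upwards [ae_all_iff.2 hup, ae_all_iff.2 hdown] with ω h1 h2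
  rw [Metric.tendsto_nhds]
  intro ε hε
  obtain ⟨n, hn⟩ := exists_nat_one_div_lt hε
  filter_upwards [h1 n, h2 n] with t ht1 ht2
  simp only [mul_neg, Finset.sum_neg_distrib] at ht2
  rw [Real.dist_eq, sub_zero, abs_lt]
  constructor <;> linarith

end

/-! ### Sufficiency when `α < 1` -/

theorem tendsto_inv_scale {α β : ℝ} (hα : 0 < α) (hαβ : α ≤ β) :
    Tendsto (fun t => (scale α β t)⁻¹) cofinite (𝓝 0) := by
  have h := (summable_inv_scale_rpow hα hαβ).tendsto_cofinite_zero
  have hr : 0 < α / 2 := by positivity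
  have h2 := h.rpow_const (p := α / 2) (Or.inr hr.le)
  rw [Real.zero_rpow hr.ne'] at h2
  refine h2.congr fun t => ?_
  have := scale_pos α β t
  rw [← Real.rpow_mul (by positivity)]
  have : 2 / α * (α / 2) = 1 := by field_simp
  rw [this, Real.rpow_one]

theorem eventually_scale_inv_mul_le {α β : ℝ} (hα : 0 < α) (hαβ : α ≤ β) (B : ℝ) {η : ℝ}
    (hη : 0 < η) : ∀ᶠ t in cofinite, (scale α β t)⁻¹ * B ≤ η := by
  have h := (tendsto_inv_scale hα hαβ).mul_const B
  rw [zero_mul] at h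
  exact (h.eventually_lt_const hη).mono fun t ht => ht.le

section
variable {Ω : Type*} [MeasurableSpace Ω] {P : Measure Ω}

/-- By Borel–Cantelli only finitely many `p` have `|X p| > η · scale p`. Their values are fixed, so
`1 / scale t` makes them negligible; for all other `p` in the rectangle, `scale p ≤ scale t`
suffices. -/
theorem MomentCondition.ae_eventually_weight_mul_le {X : ℕ × ℕ → Ω → ℝ}
    (hX : ∀ p, Measurable (X p)) (hident : ∀ p, IdentDistrib (X p) (X 0) P P)
    {α β : ℝ} (hα : 0 < α) (hαβ : α ≤ β) (hβ : β ≤ 1)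
    (h : MomentCondition P α β (X 0)) {η : ℝ} (hη : 0 < η) :
    ∀ᵐ ω ∂P, ∀ᶠ t in cofinite, ∀ p ∈ rectangle t, cesaroWeight α β t p * |X p ω| ≤ η := by
  have hsum : ∑' p : ℕ × ℕ, P {ω | η * scale α β p < |X p ω|} ≠ ∞ := by
    refine ne_of_eq_of_ne (tsum_congr fun p => ?_) (h.tsum_measure_ne_top hα hαβ (hX 0) hη)
    exact (hident p).measure_mem_eq (s := {x | η * scale α β p < |x|})
      (measurableSet_lt measurable_const measurable_id.abs)
  filter_upwards [ae_finite_setOfPred_mem hsum] with ω hω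
  set E := hω.toFinset with hE
  have hB : ∀ p ∈ E, |X p ω| ≤ ∑ p ∈ E, |X p ω| := fun p hp =>
    Finset.single_le_sum (f := fun p => |X p ω|) (fun _ _ => abs_nonneg _) hp
  filter_upwards [eventually_scale_inv_mul_le hα hαβ (∑ p ∈ E, |X p ω|) hη] with t ht p hp
  have hs := scale_pos α β t
  have hw := cesaroWeight_le hα (hαβ.trans hβ) (hα.trans_le hαβ) hβ t p
  refine (mul_le_mul_of_nonneg_right hw (abs_nonneg _)).trans ?_
  by_cases hpE : p ∈ E
  · exact (mul_le_mul_of_nonneg_left (hB p hpE) (by positivity)).trans ht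
  · have h1 : |X p ω| ≤ η * scale α β p := by
      by_contra hcon
      exact hpE (hω.mem_toFinset.2 (not_le.1 hcon))
    have h2 := scale_mono hα.le (hα.le.trans hαβ) hp
    rw [inv_mul_le_iff₀ hs]
    nlinarith

theorem memLp_of_integrable_abs_rpow {f : Ω → ℝ} (hf : Measurable f) {p : ℝ} (hp : 0 < p)
    (h : Integrable (fun ω => |f ω| ^ p) P) : MemLp f (ENNReal.ofReal p) P := by
  refine (integrable_norm_rpow_iff hf.aestronglyMeasurable (by simpa using hp)
    ENNReal.ofReal_ne_top).1 ?_
  rw [ENNReal.toReal_ofReal hp.le]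
  exact h

theorem integrable_abs_rpow_of_memLp {f : Ω → ℝ} {p : ℝ} (hp : 0 < p)
    (h : MemLp f (ENNReal.ofReal p) P) : Integrable (fun ω => |f ω| ^ p) P := by
  have := h.integrable_norm_rpow (by simpa using hp) ENNReal.ofReal_ne_top
  rwa [ENNReal.toReal_ofReal hp.le] at this

variable [IsProbabilityMeasure P]

theorem MomentCondition.integrable {f : Ω → ℝ} (hf : Measurable f) {α β : ℝ} (hα : 0 < α)
    (hα1 : α ≤ 1) (hαβ : α ≤ β) (h : MomentCondition P α β f) : Integrable f P := by
  have h1 := memLp_of_integrable_abs_rpow hf (by positivity)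
    (h.integrable_rpow hαβ hf.aemeasurable)
  exact h1.integrable (by simpa using (one_le_inv₀ hα).2 hα1)

theorem cesaroMean_sub_const {α β : ℝ} (hα : 0 < α) (hβ : 0 < β) (x : ℕ × ℕ → ℝ) (c : ℝ)
    (t : ℕ × ℕ) : cesaroMean α β (fun k l => x (k, l)) t.1 t.2
      = ∑ p ∈ rectangle t, cesaroWeight α β t p * (x p - c) + c := by
  simp_rw [cesaroMean_eq_sum, mul_sub, Finset.sum_sub_distrib]
  rw [← Finset.sum_mul, sum_cesaroWeight hα hβ]
  ring

/-- The means of a centred i.i.d. field with a finite moment of order `q > 1` converge as soon as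
its largest weighted term vanishes. -/
theorem ae_tendsto_sum_cesaroWeight_mul_sub {X : ℕ × ℕ → Ω → ℝ} (hX : ∀ p, Measurable (X p))
    (hindep : iIndepFun X P) (hident : ∀ p, IdentDistrib (X p) (X 0) P P)
    {α β : ℝ} (hα : 0 < α) (hαβ : α ≤ β) (hβ : β ≤ 1) {q : ℝ} (hq : 1 < q) (hq2 : q ≤ 2)
    (hXq : MemLp (X 0) (ENNReal.ofReal q) P)
    (hmax : ∀ η : ℝ, 0 < η → ∀ᵐ ω ∂P, ∀ᶠ t in cofinite, ∀ p ∈ rectangle t,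
      cesaroWeight α β t p * |X p ω| ≤ η) :
    ∀ᵐ ω ∂P, Tendsto (fun t => ∑ p ∈ rectangle t,
      cesaroWeight α β t p * (X p ω - ∫ ω, X 0 ω ∂P)) cofinite (𝓝 0) := by
  set μ := ∫ ω, X 0 ω ∂P with hμ
  have hβ0 : 0 < β := hα.trans_le hαβ
  have hα1 : α ≤ 1 := hαβ.trans hβ
  have hXi : ∀ p, Integrable (X p) P := fun p =>
    (hident p).integrable_iff.2 (hXq.integrable (by simpa using hq.le))
  have hident' : ∀ p, IdentDistrib (fun ω => X p ω - μ) (fun ω => X 0 ω - μ) P P := fun p =>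
    (hident p).comp (measurable_id.sub_const μ)
  have hidentq : ∀ p, IdentDistrib (fun ω => |X p ω - μ| ^ q) (fun ω => |X 0 ω - μ| ^ q) P P :=
    fun p => (hident p).comp (((measurable_id.sub_const μ).abs).pow_const q)
  refine ae_tendsto_weighted_sum (X := fun p ω => X p ω - μ) (q := q)
    (M := ∫ ω, |X 0 ω - μ| ^ q ∂P) (e := fun t => (scale α β t)⁻¹) (r := 2 / α)
    (fun p => (hX p).sub_const μ) (hindep.comp (fun _ x => x - μ) fun _ => by fun_prop)
    (fun p => (hXi p).sub (integrable_const μ)) (fun p => ?_) hq hq2 (fun p => ?_) (fun p => ?_)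
    (integral_nonneg fun ω => by positivity) rectangle
    (fun t p _ => cesaroWeight_nonneg hα hβ0 t p) (fun t => (sum_cesaroWeight hα hβ0 t).le)
    (fun t p _ => cesaroWeight_le hα hα1 hβ0 hβ t p) (fun t => inv_pos.2 (scale_pos _ _ _))
    (fun t => inv_le_one_of_one_le₀ (one_le_scale hα.le hβ0.le t)) (by positivity)
    (summable_inv_scale_rpow hα hαβ) (fun η hη => ?_)
  · rw [integral_sub (hXi p) (integrable_const μ), (hident p).integral_eq]
    simp [hμ]
  · refine (hidentq p).integrable_iff.2 ?_
    exact integrable_abs_rpow_of_memLp (by linarith) (hXq.sub (memLp_const μ))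
  · exact (hidentq p).integral_eq.le
  · filter_upwards [hmax (η / 2) (by positivity)] with ω hω
    filter_upwards [hω, eventually_scale_inv_mul_le hα hαβ |μ| (half_pos hη)] with t h1 h2 p hp
    have hw0 := cesaroWeight_nonneg hα hβ0 t p
    have hw := cesaroWeight_le hα hα1 hβ0 hβ t p
    calc cesaroWeight α β t p * |X p ω - μ|
        ≤ cesaroWeight α β t p * (|X p ω| + |μ|) := by
          gcongr
          exact abs_sub _ _
      _ = cesaroWeight α β t p * |X p ω| + cesaroWeight α β t p * |μ| := mul_add _ _ _
      _ ≤ η / 2 + η / 2 := by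
          gcongr
          · exact h1 p hp
          · exact (mul_le_mul_of_nonneg_right hw (abs_nonneg _)).trans h2
      _ = η := add_halves η

theorem MomentCondition.ae_tendsto_cesaroMean_of_lt_one {X : ℕ × ℕ → Ω → ℝ}
    (hX : ∀ p, Measurable (X p)) (hindep : iIndepFun X P)
    (hident : ∀ p, IdentDistrib (X p) (X 0) P P)
    {α β : ℝ} (hα : 0 < α) (hα1 : α < 1) (hαβ : α ≤ β) (hβ : β ≤ 1)
    (h : MomentCondition P α β (X 0)) :
    ∀ᵐ ω ∂P, Tendsto (fun t : ℕ × ℕ => cesaroMean α β (fun k l => X (k, l) ω) t.1 t.2) cofinite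
      (𝓝 (∫ ω, X 0 ω ∂P)) := by
  have h1 : 1 < 1 / α := (one_lt_div hα).2 hα1
  have hp := memLp_of_integrable_abs_rpow (hX 0) (by positivity)
    (h.integrable_rpow hαβ (hX 0).aemeasurable)
  -- The exponential estimate needs `1 < q ≤ 2`, hence `q = min (1/α) 2`; `α < 1` enters here.
  have hq := hp.mono_exponent (p := ENNReal.ofReal (min (1 / α) 2))
    (ENNReal.ofReal_le_ofReal (min_le_left _ _))
  filter_upwards [ae_tendsto_sum_cesaroWeight_mul_sub hX hindep hident hα hαβ hβ
    (lt_min h1 one_lt_two) (min_le_right _ _) hq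
    fun η hη => h.ae_eventually_weight_mul_le hX hident hα hαβ hβ hη] with ω hω
  have h2 := hω.add_const (∫ ω, X 0 ω ∂P)
  rw [zero_add] at h2
  refine h2.congr fun t => ?_
  rw [cesaroMean_sub_const hα (hα.trans_le hαβ) (fun p => X p ω)]

end

/-! ### Dyadic sums and dyadic rectangles -/

theorem tsum_ofReal_two_mul_pow (n : ℕ) :
    ∑' j : ℕ, ENNReal.ofReal ((1 / 2) ^ (j + n)) = ENNReal.ofReal (2 * (1 / 2) ^ n) := by
  simp_rw [pow_add]
  rw [← ENNReal.ofReal_tsum_of_nonneg (fun j => by positivity)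
    (summable_geometric_two.mul_right _), tsum_mul_right, tsum_geometric_two]

/-- A geometric tail is twice its first term, which is at most `1 / y`. -/
theorem tsum_ite_le_two_pow_le {y : ℝ} (hy : 0 < y) (i : ℕ) :
    ∑' j : ℕ, (if y ≤ 2 ^ (i + j) then ENNReal.ofReal ((1 / 2) ^ (i + j)) else 0)
      ≤ ENNReal.ofReal (2 / y) := by
  have hex : ∃ n : ℕ, y ≤ 2 ^ (i + n) := by
    obtain ⟨n, hn⟩ := pow_unbounded_of_one_lt y (one_lt_two (α := ℝ))
    exact ⟨n, hn.le.trans (pow_le_pow_right₀ one_le_two (by omega))⟩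
  obtain ⟨n, hspec, hmin⟩ : ∃ n : ℕ, y ≤ 2 ^ (i + n) ∧ ∀ j < n, ¬ y ≤ 2 ^ (i + j) := by
    classical
    exact ⟨Nat.find hex, Nat.find_spec hex, fun j hj => Nat.find_min hex hj⟩
  rw [← Summable.sum_add_tsum_nat_add' (k := n) ENNReal.summable, Finset.sum_eq_zero, zero_add]
  · calc _ ≤ ∑' j : ℕ, ENNReal.ofReal ((1 / 2) ^ (j + (i + n))) := by
          refine ENNReal.tsum_le_tsum fun j => ?_
          have : i + (j + n) = j + (i + n) := by omega
          rw [this]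
          split_ifs
          · exact le_rfl
          · exact zero_le
      _ = ENNReal.ofReal (2 * (1 / 2) ^ (i + n)) := tsum_ofReal_two_mul_pow _
      _ ≤ _ := by
          refine ENNReal.ofReal_le_ofReal ?_
          rw [one_div, inv_pow, ← div_eq_mul_inv]
          gcongr
  · intro j hj
    exact if_neg (hmin j (Finset.mem_range.1 hj))

theorem card_two_pow_lt_le {y : ℝ} (N : ℕ) (hN : N = ⌈Real.log y / Real.log 2⌉₊) :
    (∀ i : ℕ, (2 : ℝ) ^ i < y → i < N) ∧ (N : ℝ) ≤ 3 * logPlus y := by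
  have hl : 0 < Real.log 2 := Real.log_pos one_lt_two
  constructor
  · intro i hi
    rw [hN, Nat.lt_ceil, lt_div_iff₀ hl, ← Real.log_pow]
    exact Real.log_lt_log (by positivity) hi
  · have h1 := one_le_logPlus y
    have h2 : Real.log y ≤ logPlus y := le_max_left _ _
    rcases le_or_gt (Real.log y / Real.log 2) 0 with h | h
    · rw [hN, Nat.ceil_eq_zero.2 h]
      push_cast
      linarith
    · have h3 := Nat.ceil_lt_add_one h.le
      have h4 : Real.log y / Real.log 2 ≤ 2 * logPlus y := by
        rw [div_le_iff₀ hl]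
        have := Real.log_two_gt_d9
        nlinarith
      rw [hN]
      linarith

theorem tsum_tsum_ite_le_two_pow_le {y : ℝ} (hy : 0 < y) :
    ∑' i : ℕ, ∑' j : ℕ, (if y ≤ 2 ^ (i + j) then ENNReal.ofReal ((1 / 2) ^ (i + j)) else 0)
      ≤ ENNReal.ofReal (10 * logPlus y / y) := by
  obtain ⟨hN1, hN2⟩ := card_two_pow_lt_le (y := y) _ rfl
  set N := ⌈Real.log y / Real.log 2⌉₊
  -- Each of the `N ≤ 3 log⁺ y` rows with `i < N` costs at most `2/y`. In the others `y ≤ 2^i`, so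
  -- the whole row counts and costs `2 · 2^(-i)`; together they cost at most `4/y`. As `log⁺ y ≥ 1`,
  -- the total constant is `10`.
  have hsplit : ∀ i : ℕ,
      ∑' j : ℕ, (if y ≤ 2 ^ (i + j) then ENNReal.ofReal ((1 / 2) ^ (i + j)) else 0)
      ≤ (if i < N then ENNReal.ofReal (2 / y) else 0)
        + 2 * (if y ≤ 2 ^ (0 + i) then ENNReal.ofReal ((1 / 2) ^ (0 + i)) else 0) := by
    intro i
    by_cases hi : i < N
    · rw [if_pos hi]
      exact (tsum_ite_le_two_pow_le hy i).trans le_self_add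
    · have h2 : y ≤ 2 ^ (0 + i) := by
        rw [zero_add]
        exact not_lt.1 fun h => hi (hN1 i h)
      rw [if_neg hi, if_pos h2, zero_add, zero_add]
      calc _ ≤ ∑' j : ℕ, ENNReal.ofReal ((1 / 2) ^ (j + i)) := by
            refine ENNReal.tsum_le_tsum fun j => ?_
            rw [add_comm i j]
            split_ifs
            · exact le_rfl
            · exact zero_le
        _ = _ := by
            rw [tsum_ofReal_two_mul_pow, ENNReal.ofReal_mul zero_le_two]
            simp
  refine (ENNReal.tsum_le_tsum hsplit).trans ?_
  rw [ENNReal.tsum_add, ENNReal.tsum_mul_left]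
  have h1 : ∑' i : ℕ, (if i < N then ENNReal.ofReal (2 / y) else 0)
      = ENNReal.ofReal (N * (2 / y)) := by
    rw [tsum_eq_sum (s := Finset.range N) (fun i hi => if_neg (by simpa using hi)),
      Finset.sum_congr rfl fun i hi => if_pos (Finset.mem_range.1 hi), Finset.sum_const,
      Finset.card_range, nsmul_eq_mul, ENNReal.ofReal_mul (by positivity), ENNReal.ofReal_natCast]
  rw [h1]
  calc _ ≤ ENNReal.ofReal (N * (2 / y)) + ENNReal.ofReal 2 * ENNReal.ofReal (2 / y) := by
        have := tsum_ite_le_two_pow_le hy 0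
        gcongr
        simp
    _ = ENNReal.ofReal (N * (2 / y) + 2 * (2 / y)) := by
        rw [← ENNReal.ofReal_mul zero_le_two, ← ENNReal.ofReal_add (by positivity) (by positivity)]
    _ ≤ _ := by
        refine ENNReal.ofReal_le_ofReal ?_
        have h3 := one_le_logPlus y
        rw [← add_mul, mul_div_assoc', div_le_div_iff_of_pos_right hy]
        linarith

theorem logPlus_mono {x y : ℝ} (hx : 0 ≤ x) (hxy : x ≤ y) : logPlus x ≤ logPlus y := by
  rcases hx.eq_or_lt with rfl | hx
  · simp only [logPlus, Real.log_zero]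
    exact max_le (le_max_of_le_right zero_le_one) (le_max_right _ _)
  · exact max_le_max (Real.log_le_log hx hxy) le_rfl

theorem cesaroWeight_one_one {t p : ℕ × ℕ} : cesaroWeight 1 1 t p = (scale 1 1 t)⁻¹ := by
  have h0 : ∀ n, cesaroNumber (1 - 1) n = 1 := by
    intro n
    induction n with
    | zero => exact cesaroNumber_zero_right _
    | succ n ih =>
      rw [cesaroNumber_succ, ih, one_mul, sub_self, zero_add]
      exact div_self (by positivity)
  have h1 : ∀ n : ℕ, cesaroNumber 1 n = (n : ℝ) + 1 := by
    intro n
    rw [← sum_cesaroNumber, Finset.sum_congr rfl fun k _ => h0 k]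
    simp
  rw [cesaroWeight, h0, h0, h1, h1]
  simp [scale]

/-- The corner of the dyadic rectangle with `2^i` rows and `2^j` columns. -/
def dyadicCorner (b : ℕ × ℕ) : ℕ × ℕ := (2 ^ b.1 - 1, 2 ^ b.2 - 1)

theorem scale_dyadicCorner (b : ℕ × ℕ) : scale 1 1 (dyadicCorner b) = 2 ^ (b.1 + b.2) := by
  have h : ∀ n : ℕ, (((2 ^ n - 1 : ℕ) : ℝ) + 1) = 2 ^ n := fun n => by
    rw [Nat.cast_sub Nat.one_le_two_pow]
    push_cast
    ring
  simp [scale, dyadicCorner, pow_add]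

theorem card_rectangle (t : ℕ × ℕ) : ((rectangle t).card : ℝ) = scale 1 1 t := by
  simp [rectangle, scale]

theorem dyadicCorner_injective : Function.Injective dyadicCorner := by
  intro b c h
  have hinj : ∀ m n : ℕ, 2 ^ m - 1 = 2 ^ n - 1 → m = n := fun m n hmn => by
    have h1 := Nat.one_le_two_pow (n := m)
    have h2 := Nat.one_le_two_pow (n := n)
    exact Nat.pow_right_injective le_rfl (show 2 ^ m = 2 ^ n by omega)
  simp only [dyadicCorner, Prod.mk.injEq] at h
  exact Prod.ext (hinj _ _ h.1) (hinj _ _ h.2)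

/-! ### Sufficiency when `α = β = 1` -/

section
variable {Ω : Type*} [MeasurableSpace Ω] {P : Measure Ω}

theorem MomentCondition.mono {α β : ℝ} (hα : 0 < α) {f g : Ω → ℝ} (hg : Measurable g)
    (hgf : ∀ ω, |g ω| ≤ |f ω|) (h : MomentCondition P α β f) : MomentCondition P α β g := by
  refine ⟨fun hlt => (h.1 hlt).mono (hg.abs.pow_const _).aestronglyMeasurable
    (.of_forall fun ω => ?_), fun heq => (h.2 heq).mono ((hg.abs.pow_const _).mul
      (measurable_logPlus.comp hg.abs)).aestronglyMeasurable (.of_forall fun ω => ?_)⟩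
  · have := hgf ω
    rw [Real.norm_of_nonneg (by positivity), Real.norm_of_nonneg (by positivity)]
    gcongr
  · have h1 := one_le_logPlus |g ω|
    have h2 := one_le_logPlus |f ω|
    have h3 := logPlus_mono (abs_nonneg _) (hgf ω)
    rw [Real.norm_of_nonneg (by positivity), Real.norm_of_nonneg (by positivity)]
    have := hgf ω
    gcongr

/-- These are the Chebyshev bounds over dyadic rectangles. After exchanging sum and integral, the
double dyadic series costs a factor `log⁺ Y / Y` against `Y^2`, leaving `Y log⁺ Y`. -/
theorem tsum_lintegral_cutoff_sq_ne_top {Y : Ω → ℝ} (hY : Measurable Y) (hY0 : 0 ≤ Y)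
    (h : MomentCondition P 1 1 Y) :
    ∑' b : ℕ × ℕ, ∫⁻ ω, ENNReal.ofReal (cutoff (2 ^ (b.1 + b.2)) (Y ω) ^ 2
      * (1 / 2) ^ (b.1 + b.2)) ∂P ≠ ∞ := by
  have hm : ∀ b : ℕ × ℕ, Measurable fun ω => ENNReal.ofReal (cutoff (2 ^ (b.1 + b.2)) (Y ω) ^ 2
      * (1 / 2) ^ (b.1 + b.2)) := fun b =>
    ((((measurable_cutoff _).comp hY).pow_const 2).mul_const _).ennreal_ofReal
  rw [← lintegral_tsum fun b => (hm b).aemeasurable]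
  refine ne_top_of_le_ne_top (((h.2 rfl).const_mul 10).lintegral_lt_top).ne
    (lintegral_mono fun ω => ?_)
  simp only [div_one, Real.rpow_one]
  have hy0 : 0 ≤ Y ω := hY0 ω
  rw [abs_of_nonneg hy0]
  generalize Y ω = y at hy0 ⊢
  rcases hy0.eq_or_lt with rfl | hy
  · simp [cutoff]
  have h1 : ∀ b : ℕ × ℕ, ENNReal.ofReal (cutoff (2 ^ (b.1 + b.2)) y ^ 2 * (1 / 2) ^ (b.1 + b.2))
      = ENNReal.ofReal (y ^ 2) *
        (if y ≤ 2 ^ (b.1 + b.2) then ENNReal.ofReal ((1 / 2) ^ (b.1 + b.2)) else 0) := by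
    intro b
    unfold cutoff
    rw [abs_of_pos hy]
    split_ifs
    · rw [ENNReal.ofReal_mul (by positivity)]
    · simp
  simp_rw [h1]
  rw [ENNReal.tsum_mul_left, ENNReal.tsum_prod']
  refine (mul_le_mul_right (tsum_tsum_ite_le_two_pow_le hy) _).trans (le_of_eq ?_)
  rw [← ENNReal.ofReal_mul (by positivity)]
  congr 1
  field_simp

theorem tendsto_integral_cutoff {f : Ω → ℝ} (hf : Measurable f) (hfi : Integrable f P) :
    Tendsto (fun L : ℕ => ∫ ω, |f ω - cutoff L (f ω)| ∂P) atTop (𝓝 0) := by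
  have h0 : (0 : ℝ) = ∫ _, (0 : ℝ) ∂P := by simp
  rw [h0]
  refine tendsto_integral_of_dominated_convergence (fun ω => |f ω|)
    (fun L => (hf.sub ((measurable_cutoff _).comp hf)).abs.aestronglyMeasurable) hfi.abs
    (fun L => .of_forall fun ω => ?_) (.of_forall fun ω => ?_)
  · unfold cutoff
    split_ifs <;> simp
  · refine tendsto_const_nhds.congr' ?_
    filter_upwards [eventually_ge_atTop ⌈|f ω|⌉₊] with L hL
    rw [cutoff, if_pos (Nat.ceil_le.1 hL)]
    simp

variable [IsProbabilityMeasure P]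

/-- The truncated sum has mean at most `ηM`, so reaching `2ηM` is a deviation of at least `ηM`, to
which Chebyshev applies. -/
theorem measure_sum_cutoff_ge_le_of_mean_le {ι : Type*} {Y : ι → Ω → ℝ} {o : ι}
    (hY : ∀ p, Measurable (Y p))
    (hindep : iIndepFun Y P) (hident : ∀ p, IdentDistrib (Y p) (Y o) P P)
    (hY0 : ∀ p, 0 ≤ Y p) (hYi : Integrable (Y o) P)
    {η : ℝ} (hη : 0 < η) (hmean : ∫ ω, Y o ω ∂P ≤ η) {s : Finset ι} {M : ℝ} (hM : 0 < M)
    (hs : (s.card : ℝ) = M) :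
    P {ω | 2 * η * M ≤ ∑ p ∈ s, cutoff M (Y p ω)} ≤
      ENNReal.ofReal ((η ^ 2)⁻¹ * ((∫ ω, cutoff M (Y o ω) ^ 2 ∂P) / M)) := by
  set Z : ι → Ω → ℝ := fun p ω => cutoff M (Y p ω) with hZ
  have hZm : ∀ p, Measurable (Z p) := fun p => (measurable_cutoff M).comp (hY p)
  have hZi : iIndepFun Z P := hindep.comp (fun _ => cutoff M) fun _ => measurable_cutoff M
  have hZid : ∀ p, IdentDistrib (Z p) (Z o) P P := fun p =>
    (hident p).comp (measurable_cutoff M)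
  have hZ2 : ∀ p, MemLp (Z p) 2 P := fun p =>
    MemLp.of_bound (hZm p).aestronglyMeasurable M (.of_forall fun ω => abs_cutoff_le hM.le _)
  have hZint : ∀ p, Integrable (Z p) P := fun p => (hZ2 p).integrable one_le_two
  have hZmean : ∫ ω, Z o ω ∂P ≤ η := by
    refine le_trans (integral_mono (hZint o) hYi fun ω => ?_) hmean
    simp only [hZ, cutoff]
    split_ifs
    · exact le_rfl
    · exact hY0 o ω
  have hSmean : ∫ ω, (∑ p ∈ s, Z p) ω ∂P ≤ η * M := by
    simp only [Finset.sum_apply]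
    rw [integral_finsetSum _ fun p _ => hZint p,
      Finset.sum_congr rfl fun p _ => (hZid p).integral_eq, Finset.sum_const, nsmul_eq_mul, hs,
      mul_comm]
    gcongr
  have hvar : Var[∑ p ∈ s, Z p; P] ≤ M * ∫ ω, Z o ω ^ 2 ∂P := by
    rw [IndepFun.variance_sum (fun p _ => hZ2 p) fun p _ q _ hpq => hZi.indepFun hpq,
      Finset.sum_congr rfl fun p _ => (hZid p).variance_eq, Finset.sum_const, nsmul_eq_mul, hs]
    exact mul_le_mul_of_nonneg_left
      (variance_le_expectation_sq (hZm o).aestronglyMeasurable) hM.le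
  have hcheb := meas_ge_le_variance_div_sq (μ := P) (X := ∑ p ∈ s, Z p)
    (memLp_finsetSum' _ fun p _ => hZ2 p) (c := η * M) (by positivity)
  refine (measure_mono fun ω hω => ?_).trans (hcheb.trans (ENNReal.ofReal_le_ofReal ?_))
  · change η * M ≤ |_|
    refine le_trans ?_ (le_abs_self _)
    have h1 : 2 * η * M ≤ ∑ p ∈ s, Z p ω := hω
    rw [Finset.sum_apply]
    linarith
  · rw [div_le_iff₀ (by positivity)]
    refine hvar.trans (le_of_eq ?_)
    field_simp
    rfl

theorem ae_eventually_dyadic_sum_lt {Y : ℕ × ℕ → Ω → ℝ} (hY : ∀ p, Measurable (Y p))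
    (hindep : iIndepFun Y P) (hident : ∀ p, IdentDistrib (Y p) (Y 0) P P)
    (hY0 : ∀ p, 0 ≤ Y p) (h : MomentCondition P 1 1 (Y 0))
    {η : ℝ} (hη : 0 < η) (hmean : ∫ ω, Y 0 ω ∂P ≤ η) :
    ∀ᵐ ω ∂P, ∀ᶠ b in cofinite, ∑ p ∈ rectangle (dyadicCorner b), Y p ω
      < 2 * η * 2 ^ (b.1 + b.2) := by
  have hbound : ∀ b : ℕ × ℕ, P {ω | 2 * η * 2 ^ (b.1 + b.2)
        ≤ ∑ p ∈ rectangle (dyadicCorner b), cutoff (2 ^ (b.1 + b.2)) (Y p ω)}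
      ≤ ENNReal.ofReal (η ^ 2)⁻¹ * ∫⁻ ω, ENNReal.ofReal (cutoff (2 ^ (b.1 + b.2)) (Y 0 ω) ^ 2
        * (1 / 2) ^ (b.1 + b.2)) ∂P := by
    intro b
    refine (measure_sum_cutoff_ge_le_of_mean_le hY hindep hident hY0
      (h.integrable (hY 0) one_pos le_rfl le_rfl) hη hmean (by positivity)
      ((card_rectangle _).trans (scale_dyadicCorner b))).trans (le_of_eq ?_)
    rw [ENNReal.ofReal_mul (by positivity), ← integral_div,
      ofReal_integral_eq_lintegral_ofReal _ (.of_forall fun ω => by positivity)]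
    · congr 1
      refine lintegral_congr fun ω => ?_
      congr 1
      rw [one_div, inv_pow, div_eq_mul_inv]
    · refine Integrable.of_bound (C := (2 ^ (b.1 + b.2)) ^ 2 / 2 ^ (b.1 + b.2))
        ((((measurable_cutoff _).comp (hY 0)).pow_const 2).div_const _).aestronglyMeasurable
        (.of_forall fun ω => ?_)
      rw [Real.norm_of_nonneg (by positivity), ← sq_abs]
      have := abs_cutoff_le (η := 2 ^ (b.1 + b.2)) (by positivity) (Y 0 ω)
      gcongr
  have hsum := ne_top_of_le_ne_top (ENNReal.mul_ne_top ENNReal.ofReal_ne_top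
    (tsum_lintegral_cutoff_sq_ne_top (hY 0) (hY0 0) h))
    ((ENNReal.tsum_le_tsum hbound).trans ENNReal.tsum_mul_left.le)
  -- For `α = β = 1` and level `1`, the vanishing of the largest weighted term says that eventually
  -- no entry of the rectangle exceeds its area, so the truncation is inactive.
  filter_upwards [ae_finite_setOfPred_mem hsum, h.ae_eventually_weight_mul_le hY hident one_pos
    le_rfl le_rfl one_pos] with ω h1 h2
  filter_upwards [h1.compl_mem_cofinite, dyadicCorner_injective.tendsto_cofinite.eventually h2]
    with b hb1 hb2
  refine lt_of_eq_of_lt (Finset.sum_congr rfl fun p hp => ?_) (not_le.1 hb1)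
  have h3 := hb2 p hp
  rw [cesaroWeight_one_one, scale_dyadicCorner, inv_mul_le_iff₀ (by positivity), mul_one] at h3
  rw [cutoff, if_pos h3]

theorem tendsto_clog_add_one :
    Tendsto (fun m : ℕ => Nat.clog 2 (m + 1)) atTop atTop := by
  refine tendsto_atTop_atTop.2 fun n => ⟨2 ^ n, fun m hm => ?_⟩
  by_contra hlt
  have h1 := Nat.le_pow_clog one_lt_two (m + 1)
  have h2 := Nat.pow_le_pow_right two_pos (not_le.1 hlt).le
  omega

theorem two_pow_clog_le (m : ℕ) : 2 ^ Nat.clog 2 (m + 1) ≤ 2 * (m + 1) := by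
  rcases Nat.eq_zero_or_pos m with rfl | hm
  · simp
  · have h1 := Nat.pow_pred_clog_lt_self one_lt_two (x := m + 1) (by omega)
    have h2 : 0 < Nat.clog 2 (m + 1) := Nat.clog_pos one_lt_two (by omega)
    have h3 : Nat.clog 2 (m + 1) = (Nat.clog 2 (m + 1)).pred + 1 := by
      rw [Nat.pred_eq_sub_one]; omega
    rw [h3, pow_succ]
    omega

/-- The terms being nonnegative, a rectangle may be enlarged to a dyadic one of at most four times
its size; `8η = 4 · 2η`. -/
theorem ae_eventually_average_le {Y : ℕ × ℕ → Ω → ℝ} (hY : ∀ p, Measurable (Y p))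
    (hindep : iIndepFun Y P) (hident : ∀ p, IdentDistrib (Y p) (Y 0) P P)
    (hY0 : ∀ p, 0 ≤ Y p) (h : MomentCondition P 1 1 (Y 0))
    {η : ℝ} (hη : 0 < η) (hmean : ∫ ω, Y 0 ω ∂P ≤ η) :
    ∀ᵐ ω ∂P, ∀ᶠ t in atTop ×ˢ atTop,
      ∑ p ∈ rectangle t, cesaroWeight 1 1 t p * Y p ω ≤ 8 * η := by
  filter_upwards [ae_eventually_dyadic_sum_lt hY hindep hident hY0 h hη hmean] with ω hω
  have ht : Tendsto (fun t : ℕ × ℕ => (Nat.clog 2 (t.1 + 1), Nat.clog 2 (t.2 + 1)))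
      (atTop ×ˢ atTop) cofinite := by
    refine (tendsto_clog_add_one.prodMap tendsto_clog_add_one).mono_right ?_
    rw [prod_atTop_atTop_eq]
    exact atTop_le_cofinite
  filter_upwards [ht.eventually hω] with t ht
  simp_rw [cesaroWeight_one_one, ← Finset.mul_sum]
  rw [inv_mul_le_iff₀ (scale_pos _ _ _)]
  have hsub : rectangle t ⊆ rectangle
      (dyadicCorner (Nat.clog 2 (t.1 + 1), Nat.clog 2 (t.2 + 1))) := by
    intro p hp
    rw [mem_rectangle] at hp ⊢
    have h1 := Nat.le_pow_clog one_lt_two (t.1 + 1)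
    have h2 := Nat.le_pow_clog one_lt_two (t.2 + 1)
    simp only [dyadicCorner]
    omega
  have hs : (2 : ℝ) ^ (Nat.clog 2 (t.1 + 1) + Nat.clog 2 (t.2 + 1)) ≤ 4 * scale 1 1 t := by
    have h1 : ((2 : ℝ) ^ Nat.clog 2 (t.1 + 1)) ≤ 2 * (t.1 + 1) := by
      exact_mod_cast two_pow_clog_le t.1
    have h2 : ((2 : ℝ) ^ Nat.clog 2 (t.2 + 1)) ≤ 2 * (t.2 + 1) := by
      exact_mod_cast two_pow_clog_le t.2
    have := mul_le_mul h1 h2 (by positivity) (by positivity)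
    rw [pow_add]
    simp only [scale, Real.rpow_one]
    linarith
  have h3 := Finset.sum_le_sum_of_subset_of_nonneg hsub (f := fun p => Y p ω)
    fun p _ _ => hY0 p ω
  have h4 := mul_le_mul_of_nonneg_left hs (show 0 ≤ 2 * η by positivity)
  linarith [ht]

/-- Smythe's strong law of large numbers for double arrays. -/
theorem MomentCondition.ae_tendsto_cesaroMean_one {X : ℕ × ℕ → Ω → ℝ}
    (hX : ∀ p, Measurable (X p)) (hindep : iIndepFun X P)
    (hident : ∀ p, IdentDistrib (X p) (X 0) P P) (h : MomentCondition P 1 1 (X 0)) :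
    ∀ᵐ ω ∂P, Tendsto (fun t : ℕ × ℕ => cesaroMean 1 1 (fun k l => X (k, l) ω) t.1 t.2)
      (atTop ×ˢ atTop) (𝓝 (∫ ω, X 0 ω ∂P)) := by
  set μ := ∫ ω, X 0 ω ∂P with hμ
  have hXi : Integrable (X 0) P := h.integrable (hX 0) one_pos le_rfl le_rfl
  -- The factor `10 = 1 + 8 + 1` collects the bounded part, the tail, and the shift of the mean
  -- caused by truncation.
  suffices hs : ∀ n : ℕ, ∀ᵐ ω ∂P, ∀ᶠ t : ℕ × ℕ in atTop ×ˢ atTop,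
      |cesaroMean 1 1 (fun k l => X (k, l) ω) t.1 t.2 - μ| ≤ 10 * (1 / ((n : ℝ) + 1)) by
    filter_upwards [ae_all_iff.2 hs] with ω hω
    rw [Metric.tendsto_nhds]
    intro ε hε
    obtain ⟨n, hn⟩ := exists_nat_one_div_lt (show 0 < ε / 10 by positivity)
    filter_upwards [hω n] with t ht
    rw [Real.dist_eq]
    linarith
  intro n
  set η := 1 / ((n : ℝ) + 1) with hη
  have hη0 : 0 < η := by positivity
  obtain ⟨L, hL⟩ := ((tendsto_integral_cutoff (hX 0) hXi).eventually_le_const hη0).exists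
  set Z : ℕ × ℕ → Ω → ℝ := fun p ω => cutoff L (X p ω) with hZ
  set Y : ℕ × ℕ → Ω → ℝ := fun p ω => |X p ω - cutoff L (X p ω)| with hY
  have hgm : Measurable fun x : ℝ => |x - cutoff L x| :=
    (measurable_id.sub (measurable_cutoff _)).abs
  have hZm : ∀ p, Measurable (Z p) := fun p => (measurable_cutoff _).comp (hX p)
  have hYm : ∀ p, Measurable (Y p) := fun p => hgm.comp (hX p)
  have hZb : ∀ p ω, |Z p ω| ≤ L := fun p ω => abs_cutoff_le L.cast_nonneg _
  have hZint : Integrable (Z 0) P :=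
    Integrable.of_bound (hZm 0).aestronglyMeasurable L (.of_forall fun ω => hZb 0 ω)
  have hYmom : MomentCondition P 1 1 (Y 0) := by
    refine h.mono one_pos (hYm 0) fun ω => ?_
    simp only [hY, abs_abs, cutoff]
    split_ifs <;> simp
  have hZlim := ae_tendsto_sum_cesaroWeight_mul_sub (P := P) hZm
    (hindep.comp (fun _ => cutoff L) fun _ => measurable_cutoff _)
    (fun p => (hident p).comp (measurable_cutoff _)) one_pos le_rfl le_rfl one_lt_two le_rfl
    (MemLp.of_bound (hZm 0).aestronglyMeasurable L (.of_forall fun ω => hZb 0 ω)) fun η hη =>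
      .of_forall fun ω => by
        filter_upwards [eventually_scale_inv_mul_le one_pos le_rfl L hη] with t ht p hp
        rw [cesaroWeight_one_one]
        have := scale_pos 1 1 t
        exact (mul_le_mul_of_nonneg_left (hZb p ω) (by positivity)).trans ht
  have hYlim := ae_eventually_average_le hYm (hindep.comp (fun _ x => |x - cutoff L x|)
    fun _ => hgm) (fun p => (hident p).comp hgm) (fun p ω => abs_nonneg _) hYmom hη0 hL
  have hmeans : |∫ ω, Z 0 ω ∂P - μ| ≤ η := by
    rw [abs_sub_comm, hμ, ← integral_sub hXi hZint]
    exact (abs_integral_le_integral_abs).trans hL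
  filter_upwards [hZlim, hYlim] with ω h1 h2
  have hcof : (atTop ×ˢ atTop : Filter (ℕ × ℕ)) ≤ cofinite := by
    rw [prod_atTop_atTop_eq]
    exact atTop_le_cofinite
  have h1' := (h1.mono_left hcof).abs
  rw [abs_zero] at h1'
  filter_upwards [h1'.eventually_le_const hη0, h2] with t ht1 ht2
  rw [cesaroMean_sub_const one_pos one_pos (fun p => X p ω) μ, add_sub_cancel_right]
  set ζ := ∫ ω, Z 0 ω ∂P
  have hsplit : ∑ p ∈ rectangle t, cesaroWeight 1 1 t p * (X p ω - μ)
      = ∑ p ∈ rectangle t, cesaroWeight 1 1 t p * (Z p ω - ζ)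
        + ∑ p ∈ rectangle t, cesaroWeight 1 1 t p * (X p ω - Z p ω) + (ζ - μ) := by
    have h5 : ζ - μ = ∑ p ∈ rectangle t, cesaroWeight 1 1 t p * (ζ - μ) := by
      rw [← Finset.sum_mul, sum_cesaroWeight one_pos one_pos, one_mul]
    rw [h5, ← Finset.sum_add_distrib, ← Finset.sum_add_distrib]
    refine Finset.sum_congr rfl fun p _ => by ring
  have hmid : |∑ p ∈ rectangle t, cesaroWeight 1 1 t p * (X p ω - Z p ω)| ≤ 8 * η := by
    refine (Finset.abs_sum_le_sum_abs _ _).trans (le_trans (le_of_eq ?_) ht2)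
    refine Finset.sum_congr rfl fun p _ => ?_
    rw [abs_mul, abs_of_nonneg (cesaroWeight_nonneg one_pos one_pos t p)]
  rw [hsplit]
  calc _ ≤ η + 8 * η + η := (abs_add_three _ _ _).trans (by gcongr)
    _ = _ := by ring

end

/-! ### Necessity of the moment condition -/

section
variable {Ω : Type*} [MeasurableSpace Ω] {P : Measure Ω}

/-- If each `B j` is independent of the event that `j` is the last index at which some `A i`
occurs, then the union of the `A j ∩ B j` is not much less likely than that of the `A j`. -/
theorem mul_measure_biUnion_le {ι κ : Type*} [LinearOrder κ] {f : ι → κ}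
    (hf : Function.Injective f) {A B : ι → Set Ω} (hA : ∀ i, MeasurableSet (A i))
    (hB : ∀ i, MeasurableSet (B i)) {s : Finset ι} {c : ℝ≥0∞} (hc : ∀ i ∈ s, c ≤ P (B i))
    (hindep : ∀ j ∈ s, P ((A j ∩ ⋂ i ∈ s.filter fun i => f j < f i, (A i)ᶜ) ∩ B j)
      = P (A j ∩ ⋂ i ∈ s.filter fun i => f j < f i, (A i)ᶜ) * P (B j)) :
    c * P (⋃ i ∈ s, A i) ≤ P (⋃ i ∈ s, A i ∩ B i) := by
  set E : ι → Set Ω := fun j => A j ∩ ⋂ i ∈ s.filter fun i => f j < f i, (A i)ᶜ with hE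
  have hEm : ∀ j, MeasurableSet (E j) := fun j =>
    (hA j).inter (Finset.measurableSet_biInter _ fun i _ => (hA i).compl)
  have hcover : ⋃ i ∈ s, A i ⊆ ⋃ i ∈ s, E i := by
    intro ω hω
    classical
    simp only [Set.mem_iUnion, exists_prop] at hω ⊢
    obtain ⟨i, hi, hiA⟩ := hω
    obtain ⟨j, hj, hmax⟩ := (s.filter fun i => ω ∈ A i).exists_max_image f
      ⟨i, Finset.mem_filter.2 ⟨hi, hiA⟩⟩
    rw [Finset.mem_filter] at hj
    refine ⟨j, hj.1, hj.2, Set.mem_iInter₂.2 fun k hk hkA => ?_⟩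
    rw [Finset.mem_filter] at hk
    exact absurd (hmax k (Finset.mem_filter.2 ⟨hk.1, hkA⟩)) (not_le.2 hk.2)
  have hdisj' : ∀ i ∈ s, ∀ j ∈ s, f i < f j → Disjoint (E i) (E j) := by
    intro i _ j hj hij
    refine Set.disjoint_left.2 fun ω h1 h2 => ?_
    exact Set.mem_iInter₂.1 h1.2 j (Finset.mem_filter.2 ⟨hj, hij⟩) h2.1
  have hdisj : (s : Set ι).PairwiseDisjoint fun i => E i ∩ B i := by
    intro i hi j hj hij
    refine Disjoint.mono Set.inter_subset_left Set.inter_subset_left ?_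
    rcases lt_or_gt_of_ne (hf.ne hij) with h | h
    · exact hdisj' i hi j hj h
    · exact (hdisj' j hj i hi h).symm
  calc c * P (⋃ i ∈ s, A i) ≤ c * ∑ i ∈ s, P (E i) := by
        gcongr
        exact (measure_mono hcover).trans (measure_biUnion_finset_le _ _)
    _ = ∑ i ∈ s, c * P (E i) := Finset.mul_sum _ _ _
    _ ≤ ∑ i ∈ s, P (E i ∩ B i) := by
        refine Finset.sum_le_sum fun i hi => ?_
        rw [hindep i hi, mul_comm]
        exact mul_le_mul_right (hc i hi) _
    _ = P (⋃ i ∈ s, E i ∩ B i) :=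
        (measure_biUnion_finset hdisj fun i _ => (hEm i).inter (hB i)).symm
    _ ≤ _ := measure_mono (Set.iUnion₂_mono fun i _ =>
        Set.inter_subset_inter_left _ Set.inter_subset_left)

/-- The σ-algebra `m` is left free so that it can be the one generated by the variables of a
punctured rectangle. -/
theorem measurable_abs_weighted_sum_sub {ι Ω : Type*} {m : MeasurableSpace Ω} {s : Finset ι}
    {w : ι → ℝ} {μ : ℝ} {X : ι → Ω → ℝ} (hX : ∀ p ∈ s, Measurable (X p)) :
    Measurable fun ω => |∑ p ∈ s, w p * X p ω - μ| :=
  ((Finset.measurable_sum _ fun p hp => (hX p hp).const_mul (w p)).sub_const μ).abs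

/-- Lexicographic order extends the product order: indices after `j` lie outside `rectangle j`, so
the two events depend on disjoint families of variables. -/
theorem measure_last_inter_eq_mul {X : ℕ × ℕ → Ω → ℝ} (hX : ∀ p, Measurable (X p))
    (hindep : iIndepFun X P) {S : ℕ × ℕ → Set ℝ} (hS : ∀ p, MeasurableSet (S p))
    (w : ℕ × ℕ → ℝ) (μ c : ℝ) (j : ℕ × ℕ) {s : Finset (ℕ × ℕ)}
    (hs : ∀ i ∈ s, toLex j < toLex i) :
    P ((X j ⁻¹' S j ∩ ⋂ i ∈ s, (X i ⁻¹' S i)ᶜ) ∩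
        {ω | |∑ p ∈ (rectangle j).erase j, w p * X p ω - μ| ≤ c})
      = P (X j ⁻¹' S j ∩ ⋂ i ∈ s, (X i ⁻¹' S i)ᶜ) *
        P {ω | |∑ p ∈ (rectangle j).erase j, w p * X p ω - μ| ≤ c} := by
  set m : ℕ × ℕ → MeasurableSpace Ω := fun i => MeasurableSpace.comap (X i) inferInstance with hm
  have hdisj : Disjoint ({i | i = j ∨ i ∈ s} : Set (ℕ × ℕ)) {i | i ∈ (rectangle j).erase j} := by
    refine Set.disjoint_left.2 fun i hi hi' => ?_
    have h1 : i ≠ j := Finset.ne_of_mem_erase hi'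
    have h2 := mem_rectangle.1 (Finset.mem_of_mem_erase hi')
    rcases hi with rfl | hi
    · exact h1 rfl
    · have h3 := hs i hi
      rw [Prod.Lex.toLex_lt_toLex] at h3
      rcases h3 with h3 | h3 <;> omega
  have hind := indep_iSup_of_disjoint (m := m) (fun i => (hX i).comap_le) hindep.iIndep hdisj
  refine (Indep_iff _ _ P).1 hind _ _ ?_ ?_
  · have hA : ∀ i ∈ ({i | i = j ∨ i ∈ s} : Set (ℕ × ℕ)),
        MeasurableSet[⨆ i ∈ ({i | i = j ∨ i ∈ s} : Set (ℕ × ℕ)), m i] (X i ⁻¹' S i) :=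
      fun i hi => (le_iSup₂ (f := fun i (_ : i ∈ ({i | i = j ∨ i ∈ s} : Set (ℕ × ℕ))) => m i) i hi)
        _ ⟨S i, hS i, rfl⟩
    exact (hA j (Or.inl rfl)).inter
      (Finset.measurableSet_biInter _ fun i hi => (hA i (Or.inr hi)).compl)
  · have hR : Measurable[⨆ i ∈ {i | i ∈ (rectangle j).erase j}, m i]
        fun ω => |∑ p ∈ (rectangle j).erase j, w p * X p ω - μ| := by
      refine measurable_abs_weighted_sum_sub (m := ⨆ i ∈ {i | i ∈ (rectangle j).erase j}, m i)
        fun p hp => ?_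
      exact (comap_measurable (X p)).mono
        (le_iSup₂ (f := fun i (_ : i ∈ {i | i ∈ (rectangle j).erase j}) => m i) p hp) le_rfl
    exact hR measurableSet_Iic

variable [IsProbabilityMeasure P]

/-- A quantitative converse of Borel–Cantelli: by independence `3/4 ≤ ∏ (1 - p_i) ≤ exp(-∑ p_i)`,
while `exp(-1) < 3/4`. -/
theorem sum_measure_le_one_of_measure_biUnion_le {ι : Type*} {X : ι → Ω → ℝ}
    (hX : ∀ i, Measurable (X i)) (hindep : iIndepFun X P) {S : ι → Set ℝ}
    (hS : ∀ i, MeasurableSet (S i)) {s : Finset ι}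
    (h : P (⋃ i ∈ s, X i ⁻¹' S i) ≤ ENNReal.ofReal (1 / 4)) :
    ∑ i ∈ s, P (X i ⁻¹' S i) ≤ 1 := by
  have hm : ∀ i, MeasurableSet (X i ⁻¹' S i) := fun i => hX i (hS i)
  have hU : MeasurableSet (⋃ i ∈ s, X i ⁻¹' S i) := Finset.measurableSet_biUnion _ fun i _ => hm i
  have h1 : P.real (⋃ i ∈ s, X i ⁻¹' S i) ≤ 1 / 4 :=
    ENNReal.toReal_le_of_le_ofReal (by norm_num) h
  have h2 : P.real (⋂ i ∈ s, X i ⁻¹' (S i)ᶜ) = ∏ i ∈ s, (1 - P.real (X i ⁻¹' S i)) := by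
    rw [measureReal_def, hindep.measure_inter_preimage_eq_mul s fun i _ => (hS i).compl,
      ENNReal.toReal_prod]
    refine Finset.prod_congr rfl fun i _ => ?_
    rw [Set.preimage_compl, ← measureReal_def, probReal_compl_eq_one_sub (hm i)]
  have h3 : P.real (⋂ i ∈ s, X i ⁻¹' (S i)ᶜ) = 1 - P.real (⋃ i ∈ s, X i ⁻¹' S i) := by
    rw [← probReal_compl_eq_one_sub hU]
    simp only [Set.compl_iUnion, Set.preimage_compl]
  have h4 : ∏ i ∈ s, (1 - P.real (X i ⁻¹' S i)) ≤ Real.exp (-∑ i ∈ s, P.real (X i ⁻¹' S i)) := by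
    rw [← Finset.sum_neg_distrib, Real.exp_sum]
    exact Finset.prod_le_prod (fun i _ => sub_nonneg.2 measureReal_le_one)
      fun i _ => Real.one_sub_le_exp_neg _
  have h5 : ∑ i ∈ s, P.real (X i ⁻¹' S i) ≤ 1 := by
    by_contra hcon
    have h6 : Real.exp (-∑ i ∈ s, P.real (X i ⁻¹' S i)) < Real.exp (-1) :=
      Real.exp_lt_exp.2 (by linarith)
    have := Real.exp_neg_one_lt_d9
    linarith
  calc ∑ i ∈ s, P (X i ⁻¹' S i) = ENNReal.ofReal (∑ i ∈ s, P.real (X i ⁻¹' S i)) := by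
        rw [ENNReal.ofReal_sum_of_nonneg fun i _ => measureReal_nonneg]
        exact Finset.sum_congr rfl fun i _ => (ofReal_measureReal (measure_ne_top _ _)).symm
    _ ≤ 1 := by simpa using ENNReal.ofReal_le_ofReal h5

theorem exists_measure_lt_abs_le {f : Ω → ℝ} (hf : Measurable f) {δ : ℝ≥0∞} (hδ : 0 < δ) :
    ∃ n : ℕ, P {ω | (n : ℝ) < |f ω|} ≤ δ := by
  have h := tendsto_measure_iInter_atTop (μ := P) (s := fun n : ℕ => {ω | (n : ℝ) < |f ω|})
    (fun n => (measurableSet_lt measurable_const hf.abs).nullMeasurableSet)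
    (fun m n hmn ω (hω : (n : ℝ) < |f ω|) =>
      lt_of_le_of_lt (Nat.cast_le.2 hmn : (m : ℝ) ≤ n) hω) ⟨0, measure_ne_top _ _⟩
  have h0 : ⋂ n : ℕ, {ω | (n : ℝ) < |f ω|} = ∅ := by
    refine Set.eq_empty_of_forall_notMem fun ω hω => ?_
    obtain ⟨n, hn⟩ := exists_nat_ge |f ω|
    exact absurd (Set.mem_iInter.1 hω n) (not_lt.2 hn)
  rw [h0, measure_empty] at h
  exact (h.eventually_le_const hδ).exists

/-- Continuity from above: the events decrease in `N` to one on which convergence fails. -/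
theorem exists_measure_exists_lt_abs_le {F : ℕ × ℕ → Ω → ℝ} (hF : ∀ t, Measurable (F t)) {μ : ℝ}
    (h : ∀ᵐ ω ∂P, Tendsto (fun t => F t ω) (atTop ×ˢ atTop) (𝓝 μ)) {δ : ℝ≥0∞} (hδ : 0 < δ) :
    ∀ᶠ N : ℕ in atTop, P {ω | ∃ t : ℕ × ℕ, (N ≤ t.1 ∧ N ≤ t.2) ∧ 1 < |F t ω - μ|} ≤ δ := by
  have hm : ∀ N : ℕ, MeasurableSet
      {ω | ∃ t : ℕ × ℕ, (N ≤ t.1 ∧ N ≤ t.2) ∧ 1 < |F t ω - μ|} := by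
    intro N
    have : {ω | ∃ t : ℕ × ℕ, (N ≤ t.1 ∧ N ≤ t.2) ∧ 1 < |F t ω - μ|}
        = ⋃ t : ℕ × ℕ, ⋃ _ : N ≤ t.1 ∧ N ≤ t.2, {ω | 1 < |F t ω - μ|} := by
      ext ω
      simp
    rw [this]
    exact MeasurableSet.iUnion fun t => MeasurableSet.iUnion fun _ =>
      measurableSet_lt measurable_const ((hF t).sub_const μ).abs
  have hlim := tendsto_measure_iInter_atTop (μ := P) (fun N => (hm N).nullMeasurableSet)
    (fun M N hMN ω hω => hω.imp fun t ht => ⟨⟨hMN.trans ht.1.1, hMN.trans ht.1.2⟩, ht.2⟩)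
    ⟨0, measure_ne_top _ _⟩
  have h0 : P (⋂ N : ℕ, {ω | ∃ t : ℕ × ℕ, (N ≤ t.1 ∧ N ≤ t.2) ∧ 1 < |F t ω - μ|}) = 0 := by
    refine measure_mono_null (fun ω hω => ?_) (ae_iff.1 h)
    intro hlim
    have h1 := (Metric.tendsto_nhds.1 hlim) 1 one_pos
    rw [prod_atTop_atTop_eq] at h1
    obtain ⟨t₀, ht₀⟩ := eventually_atTop.1 h1
    obtain ⟨t, ht, htF⟩ := Set.mem_iInter.1 hω (max t₀.1 t₀.2)
    have h2 := ht₀ t ⟨(le_max_left _ _).trans ht.1, (le_max_right _ _).trans ht.2⟩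
    rw [Real.dist_eq] at h2
    linarith
  rw [h0] at hlim
  exact hlim.eventually_le_const hδ

/-- Almost sure Cesàro summability forces the moment condition. -/
theorem momentCondition_of_ae_tendsto_cesaroMean {X : ℕ × ℕ → Ω → ℝ}
    (hX : ∀ p, Measurable (X p)) (hindep : iIndepFun X P)
    (hident : ∀ p, IdentDistrib (X p) (X 0) P P)
    {α β μ : ℝ} (hα : 0 < α) (hαβ : α ≤ β) (hβ : β ≤ 1)
    (h : ∀ᵐ ω ∂P, Tendsto (fun t : ℕ × ℕ => cesaroMean α β (fun k l => X (k, l) ω) t.1 t.2)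
      (atTop ×ˢ atTop) (𝓝 μ)) : MomentCondition P α β (X 0) := by
  have hβ0 : 0 < β := hα.trans_le hαβ
  have hα1 : α ≤ 1 := hαβ.trans hβ
  set D : ℕ × ℕ → ℝ := fun t => cesaroNumber α t.1 * cesaroNumber β t.2 with hD
  have hDs : ∀ t, scale α β t ≤ D t := scale_le_cesaroNumber_mul hα hα1 hβ0 hβ
  have hD0 : ∀ t, 0 < D t := fun t => (scale_pos α β t).trans_le (hDs t)
  set F : ℕ × ℕ → Ω → ℝ := fun t ω => cesaroMean α β (fun k l => X (k, l) ω) t.1 t.2 with hF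
  set R : ℕ × ℕ → Ω → ℝ := fun t ω =>
    ∑ p ∈ (rectangle t).erase t, cesaroWeight α β t p * X p ω with hR
  have hFR : ∀ t ω, F t ω = X t ω / D t + R t ω := by
    intro t ω
    simp only [hF, hR]
    rw [cesaroMean_eq_sum α β (fun k l => X (k, l) ω),
      ← Finset.add_sum_erase _ _ (mem_rectangle.2 ⟨le_rfl, le_rfl⟩), cesaroWeight_self,
      div_eq_inv_mul]
  have hRm : ∀ t, Measurable (R t) := fun t =>
    Finset.measurable_sum _ fun p _ => (hX p).const_mul _
  have hFm : ∀ t, Measurable (F t) := fun t => by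
    have : F t = fun ω => X t ω / D t + R t ω := funext (hFR t)
    rw [this]
    exact ((hX t).div_const _).add (hRm t)
  -- Two errors of `1/8` leave `P (B t) ≥ 3/4 ≥ 1/2`; the decoupling factor two then turns `1/8`
  -- into the `1/4` required by `sum_measure_le_one_of_measure_biUnion_le`.
  have h8 : (0 : ℝ≥0∞) < ENNReal.ofReal (1 / 8) := by simp
  obtain ⟨n, hn⟩ := exists_measure_lt_abs_le (P := P) (hX 0) h8
  have hcof : (atTop ×ˢ atTop : Filter (ℕ × ℕ)) ≤ cofinite := by
    rw [prod_atTop_atTop_eq]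
    exact atTop_le_cofinite
  have hlarge : ∀ᶠ N : ℕ in atTop, ∀ t : ℕ × ℕ, N ≤ t.1 ∧ N ≤ t.2 → (n : ℝ) ≤ D t := by
    have h1 := hcof (eventually_scale_inv_mul_le hα hαβ n one_pos)
    rw [prod_atTop_atTop_eq] at h1
    obtain ⟨t₀, ht₀⟩ := eventually_atTop.1 h1
    filter_upwards [eventually_ge_atTop (max t₀.1 t₀.2)] with N hN t ht
    have h2 := ht₀ t ⟨(le_max_left _ _).trans (hN.trans ht.1),
      (le_max_right _ _).trans (hN.trans ht.2)⟩
    rw [inv_mul_le_iff₀ (scale_pos _ _ _), mul_one] at h2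
    exact h2.trans (hDs t)
  obtain ⟨N, hN1, hN2⟩ := (hlarge.and (exists_measure_exists_lt_abs_le hFm h h8)).exists
  -- The threshold is `3 = 1 + 2`: if `|X t| / D t > 3` and `|R t - μ| ≤ 2`, then `|F t - μ| > 1`.
  set S : ℕ × ℕ → Set ℝ := fun t => {x | 3 * D t < |x|} with hS
  have hSm : ∀ t, MeasurableSet (S t) := fun t =>
    measurableSet_lt measurable_const measurable_id.abs
  set B : ℕ × ℕ → Set Ω := fun t => {ω | |R t ω - μ| ≤ 2} with hB
  have hBm : ∀ t, MeasurableSet (B t) := fun t =>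
    measurableSet_le ((hRm t).sub_const μ).abs measurable_const
  have hBc : ∀ t : ℕ × ℕ, N ≤ t.1 ∧ N ≤ t.2 → ENNReal.ofReal (1 / 2) ≤ P (B t) := by
    intro t ht
    have h1 : P {ω | D t < |X t ω|} ≤ ENNReal.ofReal (1 / 8) := by
      refine ((hident t).measure_mem_eq (s := {x | D t < |x|})
        (measurableSet_lt measurable_const measurable_id.abs)).le.trans ?_
      exact (measure_mono fun ω hω => (hN1 t ht).trans_lt hω).trans hn
    have h2 : (B t)ᶜ ⊆ {ω | ∃ t : ℕ × ℕ, (N ≤ t.1 ∧ N ≤ t.2) ∧ 1 < |F t ω - μ|}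
        ∪ {ω | D t < |X t ω|} := by
      intro ω hω
      by_contra hcon
      simp only [Set.mem_union, not_or] at hcon
      have h3 : |F t ω - μ| ≤ 1 := not_lt.1 fun h => hcon.1 ⟨t, ht, h⟩
      have h4 : |X t ω / D t| ≤ 1 := by
        rw [abs_div, abs_of_pos (hD0 t), div_le_one (hD0 t)]
        exact not_lt.1 hcon.2
      refine hω ?_
      have h5 : R t ω - μ = (F t ω - μ) - X t ω / D t := by rw [hFR]; ring
      simp only [hB, Set.mem_ofPred_eq]
      rw [h5]
      refine (abs_sub _ _).trans ?_
      linarith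
    have h3 : P.real (B t)ᶜ ≤ 1 / 4 := by
      refine ENNReal.toReal_le_of_le_ofReal (by norm_num) ((measure_mono h2).trans
        ((measure_union_le _ _).trans ((add_le_add hN2 h1).trans (le_of_eq ?_))))
      rw [← ENNReal.ofReal_add (by norm_num) (by norm_num)]
      norm_num
    rw [probReal_compl_eq_one_sub (hBm t)] at h3
    rw [← ofReal_measureReal (μ := P) (s := B t)]
    exact ENNReal.ofReal_le_ofReal (by linarith)
  have hfin : ∀ s : Finset (ℕ × ℕ), (∀ t ∈ s, N ≤ t.1 ∧ N ≤ t.2) →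
      ∑ t ∈ s, P (X t ⁻¹' S t) ≤ 1 := by
    intro s hs
    refine sum_measure_le_one_of_measure_biUnion_le hX hindep hSm ?_
    have h1 := mul_measure_biUnion_le (P := P) (f := toLex) toLex.injective
      (A := fun t => X t ⁻¹' S t) (fun t => hX t (hSm t)) hBm (fun t ht => hBc t (hs t ht))
      fun j _ => measure_last_inter_eq_mul hX hindep hSm (cesaroWeight α β j) μ 2 j
        fun i hi => (Finset.mem_filter.1 hi).2
    have h2 : P (⋃ t ∈ s, X t ⁻¹' S t ∩ B t) ≤ ENNReal.ofReal (1 / 8) := by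
      refine (measure_mono fun ω hω => ?_).trans hN2
      simp only [Set.mem_iUnion, exists_prop] at hω
      obtain ⟨t, ht, htS, htB⟩ := hω
      refine ⟨t, hs t ht, ?_⟩
      have h3 : 3 < |X t ω / D t| := by
        rw [abs_div, abs_of_pos (hD0 t), lt_div_iff₀ (hD0 t)]
        exact htS
      have h4 : |R t ω - μ| ≤ 2 := htB
      have h5 : X t ω / D t = (F t ω - μ) - (R t ω - μ) := by rw [hFR]; ring
      rw [h5] at h3
      have := abs_sub (F t ω - μ) (R t ω - μ)
      linarith
    have h3 := h1.trans h2
    calc P (⋃ t ∈ s, X t ⁻¹' S t)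
        = ENNReal.ofReal 2 * (ENNReal.ofReal (1 / 2) * P (⋃ t ∈ s, X t ⁻¹' S t)) := by
          rw [← mul_assoc, ← ENNReal.ofReal_mul zero_le_two]
          norm_num
      _ ≤ ENNReal.ofReal 2 * ENNReal.ofReal (1 / 8) := by gcongr
      _ = ENNReal.ofReal (1 / 4) := by
          rw [← ENNReal.ofReal_mul zero_le_two]
          norm_num
  -- The probabilities are controlled only for indices at least `N`, whereas the series runs over
  -- all pairs. The shift by `N` costs a constant because `k + N + 1 ≤ (N+1)(k+1)`; `12 = 3 · 4`,
  -- with `4` from `cesaroNumber_mul_le_scale`.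
  set C : ℝ := 12 * (((N : ℝ) + 1) ^ α * ((N : ℝ) + 1) ^ β) with hC
  have hshift : ∀ p : ℕ × ℕ, 3 * D (p.1 + N, p.2 + N) ≤ C * scale α β p := by
    intro p
    have h1 := cesaroNumber_mul_le_scale hα hα1 hβ0 hβ (p.1 + N, p.2 + N)
    have h2 : ∀ k : ℕ, (((k + N : ℕ) : ℝ) + 1) ≤ ((N : ℝ) + 1) * ((k : ℝ) + 1) := by
      intro k
      push_cast
      have : (0 : ℝ) ≤ k * N := by positivity
      linarith
    have h3 : ∀ (k : ℕ) {γ : ℝ}, 0 < γ →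
        (((k + N : ℕ) : ℝ) + 1) ^ γ ≤ ((N : ℝ) + 1) ^ γ * ((k : ℝ) + 1) ^ γ := by
      intro k γ hγ
      rw [← Real.mul_rpow (by positivity) (by positivity)]
      exact Real.rpow_le_rpow (by positivity) (h2 k) hγ.le
    have h4 := mul_le_mul (h3 p.1 hα) (h3 p.2 hβ0) (by positivity) (by positivity)
    simp only [scale] at h1 ⊢
    simp only [hC, hD]
    linarith
  refine momentCondition_of_tsum_measure_ne_top hα (hX 0) (C := C) (by positivity) ?_
  refine ne_top_of_le_ne_top ENNReal.one_ne_top ?_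
  rw [ENNReal.tsum_eq_iSup_sum]
  refine iSup_le fun s => ?_
  have hinj : Function.Injective fun p : ℕ × ℕ => (p.1 + N, p.2 + N) := by
    intro p q hpq
    simp only [Prod.mk.injEq] at hpq
    exact Prod.ext (by omega) (by omega)
  refine le_trans ?_ (hfin (s.map ⟨_, hinj⟩) ?_)
  · rw [Finset.sum_map]
    refine Finset.sum_le_sum fun p _ => ?_
    rw [(hident _).measure_mem_eq (hSm _)]
    exact measure_mono fun ω hω => (hshift p).trans_lt hω
  · intro t ht
    obtain ⟨p, -, rfl⟩ := Finset.mem_map.1 ht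
    simp

end

/-! ### Assembly and reduction to measurable fields -/

theorem momentCondition_congr_identDistrib {Ω Ω' : Type*} [MeasurableSpace Ω] [MeasurableSpace Ω']
    {P : Measure Ω} {P' : Measure Ω'} {f : Ω → ℝ} {g : Ω' → ℝ} (h : IdentDistrib f g P P')
    (α β : ℝ) : MomentCondition P α β f ↔ MomentCondition P' α β g := by
  have h1 : IdentDistrib (fun ω => |f ω| ^ (1 / α)) (fun ω => |g ω| ^ (1 / α)) P P' :=
    h.comp (measurable_id.abs.pow_const (1 / α))
  have h2 : IdentDistrib (fun ω => |f ω| ^ (1 / α) * logPlus |f ω|)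
      (fun ω => |g ω| ^ (1 / α) * logPlus |g ω|) P P' :=
    h.comp ((measurable_id.abs.pow_const (1 / α)).mul (measurable_logPlus.comp measurable_id.abs))
  unfold MomentCondition
  rw [h1.integrable_iff, h2.integrable_iff]

theorem MomentCondition.ae_isCesaroSummableTo {Ω : Type*} [MeasurableSpace Ω] {P : Measure Ω}
    [IsProbabilityMeasure P] {X : ℕ × ℕ → Ω → ℝ} (hX : ∀ p, Measurable (X p))
    (hindep : iIndepFun X P) (hident : ∀ p, IdentDistrib (X p) (X 0) P P)
    {α β : ℝ} (hα : 0 < α) (hαβ : α ≤ β) (hβ : β ≤ 1) (h : MomentCondition P α β (X 0)) :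
    ∀ᵐ ω ∂P, IsCesaroSummableTo α β (fun k l => X (k, l) ω) (∫ ω, X 0 ω ∂P) := by
  rcases (hαβ.trans hβ).lt_or_eq with hα1 | rfl
  · filter_upwards [h.ae_tendsto_cesaroMean_of_lt_one hX hindep hident hα hα1 hαβ hβ] with ω hω
    refine hω.mono_left ?_
    rw [prod_atTop_atTop_eq]
    exact atTop_le_cofinite
  · obtain rfl : β = 1 := le_antisymm hβ hαβ
    exact h.ae_tendsto_cesaroMean_one hX hindep hident

/-- The strong law for measurable fields, with all hypotheses on one probability space. -/
theorem ae_isCesaroSummableTo_iff {Ω : Type*} [MeasurableSpace Ω] {P : Measure Ω}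
    [IsProbabilityMeasure P] {X : ℕ × ℕ → Ω → ℝ} (hX : ∀ p, Measurable (X p))
    (hindep : iIndepFun X P) (hident : ∀ p, IdentDistrib (X p) (X 0) P P)
    {α β μ : ℝ} (hα : 0 < α) (hαβ : α ≤ β) (hβ : β ≤ 1) :
    (∀ᵐ ω ∂P, IsCesaroSummableTo α β (fun k l => X (k, l) ω) μ) ↔
      MomentCondition P α β (X 0) ∧ (Integrable (X 0) P ∧ ∫ ω, X 0 ω ∂P = μ) := by
  constructor
  · intro h
    have hmom := momentCondition_of_ae_tendsto_cesaroMean hX hindep hident hα hαβ hβ h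
    refine ⟨hmom, hmom.integrable (hX 0) hα (hαβ.trans hβ) hαβ, ?_⟩
    -- The moment condition already gives convergence to the expectation, so uniqueness of limits at
    -- a single outcome identifies `μ`.
    obtain ⟨ω, h1, h2⟩ :=
      (h.and (hmom.ae_isCesaroSummableTo hX hindep hident hα hαβ hβ)).exists
    exact tendsto_nhds_unique h2 h1
  · rintro ⟨hmom, -, rfl⟩
    exact hmom.ae_isCesaroSummableTo hX hindep hident hα hαβ hβ

theorem mainTheorem5 {Ω Ω' : Type*} [MeasurableSpace Ω] [MeasurableSpace Ω']
    (P : Measure Ω) [IsProbabilityMeasure P] (P' : Measure Ω') [IsProbabilityMeasure P']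
    (X : ℕ → ℕ → Ω → ℝ) (Y : Ω' → ℝ)
    (h_indep : iIndepFun (fun p : ℕ × ℕ => X p.1 p.2) P)
    (h_ident : ∀ k l : ℕ, IdentDistrib (X k l) Y P P')
    (α β μ : ℝ) (hα : 0 < α) (hαβ : α ≤ β) (hβ : β ≤ 1) :
    (∀ᵐ ω ∂P, IsCesaroSummableTo α β (fun k l => X k l ω) μ) ↔
      ((α < β → Integrable (fun ω => |Y ω| ^ (1 / α)) P') ∧
        (α = β → Integrable (fun ω => |Y ω| ^ (1 / α) * logPlus |Y ω|) P')) ∧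
      (Integrable Y P' ∧ ∫ ω, Y ω ∂P' = μ) := by
  have hae : ∀ p : ℕ × ℕ, AEMeasurable (X p.1 p.2) P := fun p => (h_ident p.1 p.2).aemeasurable_fst
  -- `IdentDistrib` gives only almost everywhere measurability. Measurable versions change the
  -- countable field on a single null set.
  set Z : ℕ × ℕ → Ω → ℝ := fun p => (hae p).mk (X p.1 p.2) with hZ
  have hZm : ∀ p, Measurable (Z p) := fun p => (hae p).measurable_mk
  have hXZ : ∀ p : ℕ × ℕ, X p.1 p.2 =ᵐ[P] Z p := fun p => (hae p).ae_eq_mk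
  have hZY : ∀ p, IdentDistrib (Z p) Y P P' := fun p =>
    (IdentDistrib.of_ae_eq (hae p) (hXZ p)).symm.trans (h_ident p.1 p.2)
  have hZi : iIndepFun Z P := h_indep.congr hXZ
  have hsum : (∀ᵐ ω ∂P, IsCesaroSummableTo α β (fun k l => X k l ω) μ) ↔
      ∀ᵐ ω ∂P, IsCesaroSummableTo α β (fun k l => Z (k, l) ω) μ := by
    refine eventually_congr ?_
    filter_upwards [ae_all_iff.2 hXZ] with ω hω
    have : (fun k l => X k l ω) = fun k l => Z (k, l) ω := by
      ext k l
      exact hω (k, l)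
    rw [this]
  rw [hsum, ae_isCesaroSummableTo_iff hZm hZi (fun p => (hZY p).trans (hZY 0).symm) hα hαβ hβ,
    momentCondition_congr_identDistrib (hZY 0), (hZY 0).integrable_iff, (hZY 0).integral_eq]
  rfl
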